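/- Let $n$ be a positive integer divisible by $4$, let $\zeta_m=e^{2\pi i/m}$ and $R_m=\mathbb{Z}[\zeta_m,1/2]$. For a subring $R\subseteq\mathbb{C}$ let $U_2(R)$ (resp. $SU_2(R)$) be the group of unitary matrices in $GL_2(R)$ (resp. in $SL_2(R)$). Let $\mathcal{C}=U_2(R_4)$ be the Clifford group, let $\mathcal{G}_n=\langle \mathcal{C},\, T_n\rangle$ with $T_n=\left[\begin{smallmatrix}1&0\\0&\zeta_n\end{smallmatrix}\right]$ be the Clifford-cyclotomic group, and let $S\mathcal{G}_n=\mathcal{G}_n\cap SU_2(R_n)$. Let $\pi:U_2(\mathbb{C})\to SO_3(\mathbb{R})$ be the homomorphism given by the conjugation action $A\mapsto gAg^\dagger$ on trace-zero hermitian $2\times 2$ matrices, written in the Pauli basis $\sigma_x,\sigma_y,\sigma_z$, and let $\mathrm{Ad}$ be its restriction to $SU_2(\mathbb{C})$. Let $$\mathcal{H}=\mathrm{Ad}^{-1}(\pi(\mathcal{G}_n))\leq SU_2(\mathbb{C}).$$ Let $E_{48}\leq SU_2(\mathbb{C})$ be the binary octahedral group, i.e. the preimage under $\mathrm{Ad}$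 of the rotation group ($\cong S_4$) of the regular octahedron with vertices $\pm e_1,\pm e_2,\pm e_3$, and for $m\ge 1$ let $Q_{4m}=\langle a,x\mid a^{2m}=1,\ x^2=a^m,\ x^{-1}ax=a^{-1}\rangle$ be the (generalized) quaternion group of order $4m$. Then $S\mathcal{G}_n\subseteq\mathcal{H}$ with $[\mathcal{H}:S\mathcal{G}_n]=2$, and $$\mathcal{H}\cong E_{48}*_{Q_{16}}Q_{4n}.$$ Here the amalgamated product may be formed along any injective homomorphisms $Q_{16}\to E_{48}$ and $Q_{16}\to Q_{4n}$: such homomorphisms exist, and for every choice of them the resulting amalgamated product is isomorphic to $\mathcal{H}$. -/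

import Mathlib

namespace CliffordCyclotomic

open Matrix

/-- `U₂`, the group of `2 × 2` complex unitary matrices. -/
abbrev U2 : Type := unitaryGroup (Fin 2) ℂ

/-- `SU₂(ℂ)`. -/
abbrev SU2 : Type := specialUnitaryGroup (Fin 2) ℂ

/-- `SO₃(ℝ)`. -/
abbrev SO3 : Type := specialOrthogonalGroup (Fin 3) ℝ

/-- The inclusion `SU₂(ℂ) → U₂`. -/
def SU2.toU2 : SU2 →* U2 :=
  Submonoid.inclusion specialUnitaryGroup_le_unitaryGroup

/-! ### The adjoint map -/

/-- The Pauli basis `σ_x, σ_y, σ_z` of the real space of trace-zero hermitian `2 × 2` matrices. -/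
noncomputable def pauli : Fin 3 → Matrix (Fin 2) (Fin 2) ℂ :=
  ![!![0, 1; 1, 0], !![0, -Complex.I; Complex.I, 0], !![1, 0; 0, -1]]

/-- The `i`-th Pauli coordinate `⟨σ_i, A⟩ = Tr(σ_i A) / 2` of a trace-zero hermitian matrix `A`
(this number is real for such `A`). -/
noncomputable def pauliCoord (A : Matrix (Fin 2) (Fin 2) ℂ) (i : Fin 3) : ℝ :=
  ((1 / 2 : ℂ) * (pauli i * A).trace).re

/-- The matrix in the Pauli basis of the conjugation `A ↦ g A g†`: its `j`-th column consists of
the Pauli coordinates of `g σ_j g†`. -/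
noncomputable def conjMatrix (g : Matrix (Fin 2) (Fin 2) ℂ) : Matrix (Fin 3) (Fin 3) ℝ :=
  Matrix.of fun i j => pauliCoord (g * pauli j * gᴴ) i

theorem eq_sum_pauliCoord (A : Matrix (Fin 2) (Fin 2) ℂ) (hA : Aᴴ = A) (ht : A.trace = 0) :
    A = ∑ i, (pauliCoord A i : ℂ) • pauli i := by
  have h00 := congrFun (congrFun hA 0) 0
  have h01 := congrFun (congrFun hA 0) 1
  have h11 := congrFun (congrFun hA 1) 1
  simp only [conjTranspose_apply, Complex.ext_iff, RCLike.star_def, Complex.conj_re,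
    Complex.conj_im] at h00 h01 h11
  simp only [trace_fin_two, Complex.ext_iff, Complex.add_re, Complex.add_im, Complex.zero_re,
    Complex.zero_im] at ht
  ext i j
  fin_cases i <;> fin_cases j <;> apply Complex.ext <;>
    simp [pauliCoord, pauli, Fin.sum_univ_three, Matrix.mul_apply, Fin.sum_univ_two,
      trace_fin_two] <;> linarith [h00.2, h01.1, h01.2, h11.2, ht.1, ht.2]

theorem pauli_conjTranspose (j : Fin 3) : (pauli j)ᴴ = pauli j := by
  ext a b
  fin_cases j <;> fin_cases a <;> fin_cases b <;> simp [pauli]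

theorem pauli_trace (j : Fin 3) : (pauli j).trace = 0 := by
  fin_cases j <;> simp [pauli, trace_fin_two]

theorem conj_pauli (g : U2) (j : Fin 3) :
    (g : Matrix (Fin 2) (Fin 2) ℂ) * pauli j * (g : Matrix (Fin 2) (Fin 2) ℂ)ᴴ
      = ∑ i, (conjMatrix g i j : ℂ) • pauli i := by
  apply eq_sum_pauliCoord
  · simp [conjTranspose_mul, pauli_conjTranspose, Matrix.mul_assoc]
  · have h : (g : Matrix (Fin 2) (Fin 2) ℂ)ᴴ * (g : Matrix (Fin 2) (Fin 2) ℂ) = 1 := g.2.1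
    rw [Matrix.trace_mul_comm, ← Matrix.mul_assoc, h, Matrix.one_mul, pauli_trace]

theorem pauliCoord_sum (c : Fin 3 → ℝ) (B : Fin 3 → Matrix (Fin 2) (Fin 2) ℂ) (i : Fin 3) :
    pauliCoord (∑ k, (c k : ℂ) • B k) i = ∑ k, c k * pauliCoord (B k) i := by
  simp only [pauliCoord, Finset.mul_sum, trace_sum, Complex.re_sum, Matrix.mul_smul, trace_smul,
    smul_eq_mul]
  refine Finset.sum_congr rfl fun k _ => ?_
  rw [← Complex.re_ofReal_mul]
  congr 1
  ring

theorem conjMatrix_mul (g h : U2) :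
    conjMatrix (g * h : U2) = conjMatrix g * conjMatrix h := by
  ext i j
  have e : ((g * h : U2) : Matrix (Fin 2) (Fin 2) ℂ) * pauli j *
        ((g * h : U2) : Matrix (Fin 2) (Fin 2) ℂ)ᴴ
      = ∑ k, (conjMatrix h k j : ℂ) •
        ((g : Matrix (Fin 2) (Fin 2) ℂ) * pauli k * (g : Matrix (Fin 2) (Fin 2) ℂ)ᴴ) := by
    have e1 : ((g * h : U2) : Matrix (Fin 2) (Fin 2) ℂ) * pauli j *
        ((g * h : U2) : Matrix (Fin 2) (Fin 2) ℂ)ᴴ = (g : Matrix (Fin 2) (Fin 2) ℂ) *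
        ((h : Matrix (Fin 2) (Fin 2) ℂ) * pauli j * (h : Matrix (Fin 2) (Fin 2) ℂ)ᴴ) *
        (g : Matrix (Fin 2) (Fin 2) ℂ)ᴴ := by
      simp [conjTranspose_mul, Matrix.mul_assoc]
    rw [e1, conj_pauli, Matrix.mul_sum, Matrix.sum_mul]
    simp
  rw [conjMatrix, Matrix.of_apply, e, pauliCoord_sum, Matrix.mul_apply]
  exact Finset.sum_congr rfl fun k _ => mul_comm _ _

theorem conjMatrix_one : conjMatrix (1 : U2) = 1 := by
  ext i j
  fin_cases i <;> fin_cases j <;>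
    simp [conjMatrix, pauliCoord, pauli, trace_fin_two] <;> norm_num

theorem conjMatrix_inv (g : U2) : conjMatrix (g⁻¹ : U2) = (conjMatrix g)ᵀ := by
  ext i j
  simp only [conjMatrix, Matrix.of_apply, Matrix.transpose_apply, pauliCoord,
    UnitaryGroup.inv_val, star_eq_conjTranspose, conjTranspose_conjTranspose]
  congr 2
  have key : ∀ A B C D : Matrix (Fin 2) (Fin 2) ℂ,
      (A * (B * C * D)).trace = (C * (D * A * B)).trace := fun A B C D => by
    rw [show A * (B * C * D) = (A * B) * (C * D) by simp only [Matrix.mul_assoc],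
      Matrix.trace_mul_comm]
    simp only [Matrix.mul_assoc]
  exact key _ _ _ _

theorem conjMatrix_det (g : U2) : (conjMatrix g).det = 1 := by
  have h : (g : Matrix (Fin 2) (Fin 2) ℂ)ᴴ * (g : Matrix (Fin 2) (Fin 2) ℂ) = 1 := g.2.1
  obtain ⟨G, hG⟩ : ∃ G : Matrix (Fin 2) (Fin 2) ℂ, G = g := ⟨_, rfl⟩
  rw [← hG] at h
  have hp : pauli 0 * pauli 1 * pauli 2 = Complex.I • (1 : Matrix (Fin 2) (Fin 2) ℂ) := by
    ext a b
    fin_cases a <;> fin_cases b <;> simp [pauli]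
  have e : ((G * pauli 0 * Gᴴ) * (G * pauli 1 * Gᴴ) * (G * pauli 2 * Gᴴ)).trace
      = 2 * Complex.I := by
    have : (G * pauli 0 * Gᴴ) * (G * pauli 1 * Gᴴ) * (G * pauli 2 * Gᴴ)
        = G * (pauli 0 * (Gᴴ * G) * pauli 1 * (Gᴴ * G) * pauli 2) * Gᴴ := by
      simp only [Matrix.mul_assoc]
    rw [this, h, Matrix.mul_one, Matrix.mul_one, hp, Matrix.trace_mul_comm, ← Matrix.mul_assoc, h]
    simp
    ring
  rw [hG, conj_pauli, conj_pauli, conj_pauli] at e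
  have e2 := congrArg Complex.im e
  simp [Fin.sum_univ_three, pauli, trace_fin_two] at e2
  rw [det_fin_three]
  linarith

theorem conjMatrix_mem (g : U2) : conjMatrix g ∈ specialOrthogonalGroup (Fin 3) ℝ := by
  rw [mem_specialOrthogonalGroup_iff, mem_orthogonalGroup_iff, ← conjMatrix_inv, ← conjMatrix_mul,
    mul_inv_cancel, conjMatrix_one]
  exact ⟨rfl, conjMatrix_det g⟩

/-- The homomorphism `π : U₂ → SO₃(ℝ)` given by conjugation on trace-zero hermitian matrices,
written in the Pauli basis. -/
noncomputable def adU : U2 →* SO3 where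
  toFun g := ⟨conjMatrix g, conjMatrix_mem g⟩
  map_one' := Subtype.ext conjMatrix_one
  map_mul' g h := Subtype.ext (conjMatrix_mul g h)

/-- The adjoint map `Ad : SU₂(ℂ) → SO₃(ℝ)`. -/
noncomputable def Ad : SU2 →* SO3 := adU.comp SU2.toU2

/-! ### The Clifford-cyclotomic groups -/

/-- `U₂(R) = U₂ ∩ GL₂(R)` for a subring `R` of `ℂ`. -/
def U2Over (R : Subring ℂ) : Subgroup U2 where
  carrier := {g | (∀ i j, (g : Matrix (Fin 2) (Fin 2) ℂ) i j ∈ R) ∧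
    ∀ i j, ((g⁻¹ : U2) : Matrix (Fin 2) (Fin 2) ℂ) i j ∈ R}
  one_mem' := by
    have h : ∀ i j, ((1 : U2) : Matrix (Fin 2) (Fin 2) ℂ) i j ∈ R := fun i j => by
      rw [UnitaryGroup.one_val, Matrix.one_apply]
      split_ifs
      exacts [R.one_mem, R.zero_mem]
    exact ⟨h, by rw [inv_one]; exact h⟩
  mul_mem' {g h} hg hh := by
    refine ⟨fun i j => ?_, fun i j => ?_⟩
    · rw [UnitaryGroup.mul_val, Matrix.mul_apply]
      exact R.sum_mem fun k _ => R.mul_mem (hg.1 i k) (hh.1 k j)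
    · rw [_root_.mul_inv_rev, UnitaryGroup.mul_val, Matrix.mul_apply]
      exact R.sum_mem fun k _ => R.mul_mem (hh.2 i k) (hg.2 k j)
  inv_mem' {g} hg := ⟨hg.2, by rw [inv_inv]; exact hg.1⟩

/-- `SU₂(R) = SU₂(ℂ) ∩ SL₂(R)` for a subring `R` of `ℂ`. -/
def SU2Over (R : Subring ℂ) : Subgroup SU2 := (U2Over R).comap SU2.toU2

/-- `ζ_n = exp(2πi/n)`. -/
noncomputable def zeta (n : ℕ) : ℂ := Complex.exp (2 * Real.pi * Complex.I / n)

/-- The ring `R_n = ℤ[ζ_n, 1/2]`. -/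
noncomputable def ringR (n : ℕ) : Subring ℂ := Subring.closure {zeta n, 1 / 2}

theorem zeta_mul_conj (n : ℕ) : zeta n * (starRingEnd ℂ) (zeta n) = 1 := by
  rw [zeta, ← Complex.exp_conj, ← Complex.exp_add]
  simp [neg_div, Complex.conj_ofNat]

/-- The gate `T_n = diag(1, ζ_n)`. -/
noncomputable def gateT (n : ℕ) : U2 :=
  ⟨!![1, 0; 0, zeta n], by
    rw [mem_unitaryGroup_iff]
    ext i j
    fin_cases i <;> fin_cases j <;>
      simp [Matrix.mul_apply, Fin.sum_univ_two, star_apply, zeta_mul_conj]⟩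

/-- The Clifford group `𝒞 = U₂(R_4)`, where `R_4 = ℤ[i, 1/2]`. -/
noncomputable def cliffordGroup : Subgroup U2 := U2Over (ringR 4)

/-- The Clifford-cyclotomic group `𝒢_n = ⟨𝒞, T_n⟩`. -/
noncomputable def groupG (n : ℕ) : Subgroup U2 :=
  Subgroup.closure ((cliffordGroup : Set U2) ∪ {gateT n})

/-- The special Clifford-cyclotomic group `S𝒢_n = 𝒢_n ∩ SU₂(R_n)`, as a subgroup of `SU₂(ℂ)`. -/
noncomputable def groupSG (n : ℕ) : Subgroup SU2 :=
  (groupG n).comap SU2.toU2 ⊓ SU2Over (ringR n)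

/-- The pullback `ℋ` of `π(𝒢_n)` under `Ad : SU₂(ℂ) → SO₃(ℝ)`. -/
noncomputable def groupH (n : ℕ) : Subgroup SU2 := ((groupG n).map adU).comap Ad

/-! ### The binary octahedral group -/

/-- The vertices `±e_1, ±e_2, ±e_3` of the regular octahedron. -/
def octahedronVertices : Set (Fin 3 → ℝ) :=
  {v | ∃ i, v = Pi.single i 1 ∨ v = -Pi.single i 1}

/-- The group of rotations of the regular octahedron (isomorphic to `S₄`). -/
def octahedralGroup : Subgroup SO3 where
  carrier := {g | (fun v => (g : Matrix (Fin 3) (Fin 3) ℝ) *ᵥ v) '' octahedronVertices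
    = octahedronVertices}
  one_mem' := by simp
  mul_mem' {g h} hg hh := by
    have e : (fun v => ((g * h : SO3) : Matrix (Fin 3) (Fin 3) ℝ) *ᵥ v)
        = (fun v => (g : Matrix (Fin 3) (Fin 3) ℝ) *ᵥ v) ∘
          (fun v => (h : Matrix (Fin 3) (Fin 3) ℝ) *ᵥ v) := by
      funext v
      simp [Matrix.mulVec_mulVec]
    simp only [Set.mem_ofPred_eq] at hg hh ⊢
    rw [e, Set.image_comp, hh, hg]
  inv_mem' {g} hg := by
    have e : (fun v => ((g⁻¹ : SO3) : Matrix (Fin 3) (Fin 3) ℝ) *ᵥ v) ∘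
          (fun v => (g : Matrix (Fin 3) (Fin 3) ℝ) *ᵥ v) = id := by
      funext v
      have h : ((g⁻¹ : SO3) : Matrix (Fin 3) (Fin 3) ℝ) * (g : Matrix (Fin 3) (Fin 3) ℝ) = 1 :=
        congrArg Subtype.val (inv_mul_cancel g)
      simp [Matrix.mulVec_mulVec, h]
    simp only [Set.mem_ofPred_eq] at hg ⊢
    conv_lhs => rw [← hg]
    rw [← Set.image_comp, e, Set.image_id]

/-- `E_48`, the binary octahedral group: the preimage in `SU₂(ℂ)` of the group of rotations of
the octahedron. It is a central extension of `S₄` by `{±1}`. -/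
noncomputable def E48 : Subgroup SU2 := octahedralGroup.comap Ad

/-! ### Amalgamated products of two groups -/

/-- The family consisting of two groups `A` and `B`. -/
def AmalgamFactor (A B : Type) : Bool → Type
  | false => A
  | true => B

instance (A B : Type) [Group A] [Group B] : ∀ b, Group (AmalgamFactor A B b)
  | false => inferInstanceAs (Group A)
  | true => inferInstanceAs (Group B)

/-- The family consisting of two homomorphisms with a common source. -/
def amalgamMap {A B C : Type} [Group A] [Group B] [Group C] (f : C →* A) (g : C →* B) :
    ∀ b, C →* AmalgamFactor A B b
  | false => f
  | true => g

/-- The amalgamated product `A *_C B` along `f : C → A` and `g : C → B`, that is, the pushout of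
`f` and `g` in the category of groups. -/
abbrev Amalgam {A B C : Type} [Group A] [Group B] [Group C] (f : C →* A) (g : C →* B) : Type :=
  Monoid.PushoutI (amalgamMap f g)

end CliffordCyclotomic

/-!
# The Clifford-cyclotomic groups as amalgamated products

The group `ℋ` consists of the matrices in `SU₂(ℂ)` that become elements of `𝒢_n` after
multiplication by a scalar (`mem_groupH_iff`). It is generated by `E_48` and a lift
`diag(ζ_{2n}⁻¹, ζ_{2n})` of `T_n` (`groupH_le`), because the Clifford group and `E_48` have the
same image in `SO₃(ℝ)`. Indeed a rotation that comes from the Clifford group has coefficients in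
`ℤ[1/2]`, and a dyadic point of the unit sphere lies on a coordinate axis, since a sum of three
squares that is divisible by `4` has only even terms (`adU_mem_octahedralGroup`). The converse
inclusion uses the explicit list of the elements of `E_48` in `E48_cases`.

That `ℋ` is an amalgamated product is a ping-pong argument (`lift_injective_of_ping_pong`) on the
projective line over `ℂ`, with respect to a valuation `v` of `ℂ` with `v 2 < 1`. The near region
consists of the points `r` congruent to `1` modulo `1 + i`, and the far region of the units `r`
with `v (r - 1) ≥ v(2)^{1/4}`; monomial matrices whose entries are eighth roots of unity preserve
the near region. The other elements of `E_48` are, up to fourth roots of unity, the Hadamard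
matrix, and send the far region, as well as `0` and `∞`, into the near region
(`FarRegion.hadamard`). The elements of `Q_{4n}` outside of `Q_16` multiply `r` by a root of unity
`ω` with `ω ^ 4 ≠ 1`, up to the action of `Q_16`. For such an `ω` one has `v (ω - 1) ^ 4 ≥ v 2`
(`valuation_two_le_pow_four`), so the near region is sent into the far region.

The choice of the embeddings of `Q_16` does not matter. An element of order eight of `E_48`
permutes the three coordinate axes by a permutation that is not a `3`-cycle, so it fixes an axis
and is conjugate in `E_48` to a diagonal matrix (`exists_conj_standard`). As units modulo `8` lift
to units modulo `2n`, any embedding of `Q_16` in `Q_{4n}` can then be matched by a suitable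
embedding of `Q_{4n}` in the monomial matrices (`exists_isPrimitiveRoot_pow_eq`).

For the index, let `λ h` be in `𝒢_n` with `h` in `ℋ`. Then `λ ^ 2` is a determinant of an element
of `𝒢_n`, that is, an `n`-th root of unity, and the scalar matrices given by the `n`-th roots of
unity lie in `𝒢_n`. So `h` or `h diag(ζ_{2n}⁻¹, ζ_{2n})` lies in `S𝒢_n`. The index is not `1`,
since `ζ_{2n}` does not belong to `ℚ(ζ_n)` (`zeta_two_mul_notMem`).
-/

namespace CliffordCyclotomic

open Matrix

/-! ### A ping-pong criterion for amalgamated products -/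

section PingPong

open Monoid

variable {H K : Type*} {G : Bool → Type*} [Group H] [Group K] [∀ b, Group (G b)]
  {φ : ∀ b, H →* G b} (F : ∀ b, G b →* K) {XS XT : Set K}

/-- The combinatorial core of the ping-pong argument: a reduced word is empty, a single letter of
the second factor, or takes a value in the set that belongs to its first letter. -/
theorem prod_mem_of_reduced
    (hS0 : ∀ a ∉ (φ false).range, ∀ b, F false a * F true b ∈ XS)
    (hST : ∀ a ∉ (φ false).range, ∀ x ∈ XT, F false a * x ∈ XS)
    (hTS : ∀ b ∉ (φ true).range, ∀ x ∈ XS, F true b * x ∈ XT)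
    (l : List (Σ b, G b)) (hl : l.IsChain fun s t => s.1 ≠ t.1)
    (hr : ∀ s ∈ l, s.2 ∉ (φ s.1).range) :
    l = [] ∨ (∃ b, l = [⟨true, b⟩]) ∨
      (∃ a t, l = ⟨false, a⟩ :: t ∧ (l.map fun s => F s.1 s.2).prod ∈ XS) ∨
      (∃ b t, l = ⟨true, b⟩ :: t ∧ (l.map fun s => F s.1 s.2).prod ∈ XT) := by
  induction l with
  | nil => exact Or.inl rfl
  | cons s l ih =>
    obtain ⟨i, g⟩ := s
    have hg := hr ⟨i, g⟩ (by simp)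
    have ih := ih hl.tail fun s hs => hr s (by simp [hs])
    right
    cases i
    · right; left
      refine ⟨g, l, rfl, ?_⟩
      rcases ih with rfl | ⟨b, rfl⟩ | ⟨a, t, rfl, -⟩ | ⟨b, t, -, hx⟩
      · simpa using hS0 g hg 1
      · simpa using hS0 g hg b
      · simp at hl
      · simpa using hST g hg _ hx
    · rcases ih with rfl | ⟨b, rfl⟩ | ⟨a, t, -, hx⟩ | ⟨b, t, rfl, -⟩
      · exact Or.inl ⟨g, rfl⟩
      · simp at hl
      · right; right
        exact ⟨g, l, rfl, by simpa using hTS g hg _ hx⟩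
      · simp at hl

/-- Ping-pong for amalgamated products of two groups. The letters of the first factor outside the
amalgamated subgroup send the whole second factor and `XT` into `XS`; those of the second factor
send `XS` into `XT`; and the second factor avoids both sets. -/
theorem lift_injective_of_ping_pong (hφ : ∀ b, Function.Injective (φ b)) (k : H →* K)
    (hk : ∀ b, (F b).comp (φ b) = k) (hF : ∀ b, Function.Injective (F b))
    (hS0 : ∀ a ∉ (φ false).range, ∀ b, F false a * F true b ∈ XS)
    (hST : ∀ a ∉ (φ false).range, ∀ x ∈ XT, F false a * x ∈ XS)
    (hTS : ∀ b ∉ (φ true).range, ∀ x ∈ XS, F true b * x ∈ XT)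
    (hS : ∀ b, F true b ∉ XS) (hT : ∀ b, F true b ∉ XT) :
    Function.Injective (PushoutI.lift F k hk) := by
  classical
  rw [injective_iff_map_eq_one]
  intro x hx
  obtain ⟨d⟩ := PushoutI.NormalWord.transversal_nonempty φ hφ
  obtain ⟨w, rfl⟩ := PushoutI.NormalWord.equiv (d := d).symm.surjective x
  change PushoutI.lift F k hk w.prod = 1 at hx
  have hval : PushoutI.lift F k hk w.prod
      = F true (φ true w.head) * (w.toList.map fun s => F s.1 s.2).prod := by
    have hb : F true (φ true w.head) = k w.head := DFunLike.congr_fun (hk true) _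
    rw [PushoutI.NormalWord.prod, map_mul, PushoutI.lift_base, hb, PushoutI.ofCoprodI]
    congr 1
    rw [CoprodI.Word.prod, map_list_prod, map_list_prod, List.map_map, List.map_map]
    refine congrArg List.prod (List.map_congr_left fun s _ => ?_)
    simp
  rw [hval] at hx
  have hw : (w.toList.map fun s => F s.1 s.2).prod = F true (φ true w.head)⁻¹ := by
    rw [map_inv]; exact (inv_eq_of_mul_eq_one_right hx).symm
  have hr : ∀ s ∈ w.toList, s.2 ∉ (φ s.1).range := by
    rintro ⟨i, g⟩ hs hg
    refine w.ne_one _ hs ?_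
    have h1 := w.normalized i g hs
    -- the transversal meets the amalgamated subgroup only in `1`
    have := (d.compl i).1 (a₁ := (⟨⟨g, hg⟩, ⟨1, d.one_mem i⟩⟩ : (φ i).range × d.set i))
      (a₂ := (⟨⟨1, one_mem _⟩, ⟨g, h1⟩⟩ : (φ i).range × d.set i)) (by simp)
    simpa using congrArg (fun p => (p.1 : G i)) this
  rcases prod_mem_of_reduced F hS0 hST hTS w.toList w.chain_ne hr with
    h | ⟨b, h⟩ | ⟨a, t, -, h⟩ | ⟨b, t, -, h⟩
  · rw [h] at hw hx
    have h1 : w.head = 1 := by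
      apply hφ true; apply hF true; simpa using hx
    change w.prod = 1
    rw [PushoutI.NormalWord.prod, h1, CoprodI.Word.prod, h]
    simp
  · exfalso
    refine hr ⟨true, b⟩ (by simp [h]) ⟨w.head⁻¹, hF true ?_⟩
    rw [h] at hw
    simpa using hw.symm
  · exact absurd (hw ▸ h) (hS _)
  · exact absurd (hw ▸ h) (hT _)

end PingPong

/-! ### The 2-adic ping-pong regions -/

/-- `ℂ` carries a valuation at which `2` is not a unit. -/
theorem exists_valuation_two_lt_one :
    ∃ (A : ValuationSubring ℂ), A.valuation 2 < 1 := by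
  let I : Ideal (⊥ : Subring ℂ) := Ideal.span {2}
  have hI : I ≠ ⊤ := by
    rw [Ne, Ideal.span_singleton_eq_top]
    intro h
    obtain ⟨⟨y, hy⟩, hxy⟩ := h.exists_right_inv
    obtain ⟨m, rfl⟩ := Subring.mem_bot.1 hy
    have h2 : (2 : ℂ) * m = 1 := congrArg Subtype.val hxy
    have h3 : (2 : ℤ) * m = 1 := by exact_mod_cast h2
    omega
  obtain ⟨A, -, hA⟩ := Ideal.image_subset_nonunits_valuationSubring I hI
  refine ⟨A, ?_⟩
  rw [← ValuationSubring.mem_nonunits_iff]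
  exact hA ⟨2, Ideal.subset_span rfl, rfl⟩

section Regions

variable {Γ : Type*} [LinearOrderedCommGroupWithZero Γ] (v : Valuation ℂ Γ)

theorem valuation_of_pow_eq_one {u : ℂ} {m : ℕ} (hm : m ≠ 0) (hu : u ^ m = 1) : v u = 1 := by
  refine (pow_eq_one_iff.1 ?_).resolve_right hm
  rw [← map_pow, hu, map_one]

theorem valuation_natCast_le (m : ℕ) : v (m : ℂ) ≤ 1 := by
  induction m with
  | zero => simp
  | succ m ih =>
    rw [Nat.cast_succ]
    exact v.map_add_le ih (by simp)

theorem valuation_odd (h2 : v 2 < 1) {m : ℕ} (hm : Odd m) : v (m : ℂ) = 1 := by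
  obtain ⟨k, rfl⟩ := hm
  have h : v ((2 * k : ℕ) : ℂ) < v (1 : ℂ) := by
    rw [map_one, Nat.cast_mul, map_mul]
    exact (mul_le_of_le_one_right' (valuation_natCast_le v k)).trans_lt (by simpa using h2)
  rw [Nat.cast_add_one, v.map_add_eq_of_lt_right h, map_one]

theorem geom_sum_valuation_le {η : ℂ} (hη : v η = 1) (k : ℕ) : v (η ^ k - 1) ≤ v (η - 1) := by
  rw [← geom_sum_mul, map_mul]
  refine mul_le_of_le_one_left' (v.map_sum_le fun i _ => ?_)
  rw [map_pow, hη, one_pow]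

/-- For a root of unity `η ≠ 1`, the difference `η - 1` divides `2`: if the order of `η` is even,
then `-1` is a power of `η`, and otherwise `η - 1` divides the order, a unit. -/
theorem valuation_two_le (h2 : v 2 < 1) {η : ℂ} {m : ℕ} (hm : m ≠ 0) (hη : η ^ m = 1)
    (h1 : η ≠ 1) : v 2 ≤ v (η - 1) := by
  have hv := valuation_of_pow_eq_one v hm hη
  have ho : 0 < orderOf η := orderOf_pos_iff.2 (isOfFinOrder_iff_pow_eq_one.2 ⟨m, by omega, hη⟩)
  rcases Nat.even_or_odd (orderOf η) with he | he
  · obtain ⟨k, hk⟩ := he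
    have hkη : η ^ k = -1 := by
      have h3 : η ^ k * η ^ k = 1 := by rw [← pow_add, ← hk, pow_orderOf_eq_one]
      rcases mul_self_eq_one_iff.1 h3 with h | h
      · exact absurd (orderOf_dvd_of_pow_eq_one h)
          (fun h => by have := Nat.le_of_dvd (by omega) h; omega)
      · exact h
    have := geom_sum_valuation_le v hv k
    rwa [hkη, show (-1 - 1 : ℂ) = -2 by norm_num, Valuation.map_neg] at this
  · have hs : ∑ i ∈ Finset.range (orderOf η), η ^ i = 0 := by
      have := geom_sum_mul η (orderOf η)
      rw [pow_orderOf_eq_one, sub_self] at this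
      exact (mul_eq_zero.1 this).resolve_right (sub_ne_zero.2 h1)
    have hs2 : ((orderOf η : ℕ) : ℂ) = -∑ i ∈ Finset.range (orderOf η), (η ^ i - 1) := by
      rw [Finset.sum_sub_distrib, hs]; simp
    have h3 : v ((orderOf η : ℕ) : ℂ) ≤ v (η - 1) := by
      rw [hs2, Valuation.map_neg]
      exact v.map_sum_le fun i _ => geom_sum_valuation_le v hv i
    rw [valuation_odd v h2 he] at h3
    exact h2.le.trans h3

theorem eq_of_pow_four_eq_one {u : ℂ} (hu : u ^ 4 = 1) :
    u = 1 ∨ u = -1 ∨ u = Complex.I ∨ u = -Complex.I := by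
  have h : (u - 1) * ((u + 1) * ((u - Complex.I) * (u + Complex.I))) = 0 := by
    linear_combination hu + (1 - u ^ 2) * Complex.I_sq
  rcases mul_eq_zero.1 h with h | h
  · exact Or.inl (sub_eq_zero.1 h)
  rcases mul_eq_zero.1 h with h | h
  · exact Or.inr (Or.inl (eq_neg_of_add_eq_zero_left h))
  rcases mul_eq_zero.1 h with h | h
  · exact Or.inr (Or.inr (Or.inl (sub_eq_zero.1 h)))
  · exact Or.inr (Or.inr (Or.inr (eq_neg_of_add_eq_zero_left h)))

theorem valuation_I : v Complex.I = 1 := valuation_of_pow_eq_one v four_ne_zero Complex.I_pow_four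

theorem valuation_pow_four_sub_one_sq_le (h2 : v 2 < 1) {u : ℂ} (hu : u ^ 4 = 1) :
    v (u - 1) ^ 2 ≤ v 2 := by
  rw [← map_pow]
  rcases eq_of_pow_four_eq_one hu with rfl | rfl | rfl | rfl
  · simp
  · rw [show (-1 - 1 : ℂ) ^ 2 = 2 * 2 by norm_num, map_mul]
    exact mul_le_of_le_one_left' h2.le
  · rw [show (Complex.I - 1) ^ 2 = -(2 * Complex.I) by linear_combination Complex.I_sq,
      Valuation.map_neg, map_mul, valuation_I, mul_one]
  · rw [show (-Complex.I - 1) ^ 2 = 2 * Complex.I by linear_combination Complex.I_sq,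
      map_mul, valuation_I, mul_one]

theorem valuation_two_pos : 0 < v (2 : ℂ) := by
  rw [zero_lt_iff, Valuation.ne_zero_iff]; norm_num

/-- The fourth roots of unity `u` satisfy `v (u - 1) ≤ v(2)^{1/2}`. If this bound held for one of
the four factors `ω - u` of `ω ^ 4 - 1`, it would hold for all, and
`v (ω ^ 4 - 1) ≤ v(2)^2 < v(2)`. So it holds for none, and all four factors have the same valuation. -/
theorem valuation_two_le_pow_four (h2 : v 2 < 1) {ω : ℂ} {m : ℕ} (hm : m ≠ 0) (hω : ω ^ m = 1)
    (h4 : ω ^ 4 ≠ 1) : v 2 ≤ v (ω - 1) ^ 4 := by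
  have h0 := valuation_two_pos v
  have hle : v 2 ≤ v (ω ^ 4 - 1) :=
    valuation_two_le v h2 hm (by rw [← pow_mul, mul_comm, pow_mul, hω, one_pow]) h4
  have hfac : ω ^ 4 - 1 = (ω - 1) * (ω - -1) * (ω - Complex.I) * (ω - -Complex.I) := by
    linear_combination (ω ^ 2 - 1) * Complex.I_sq
  by_cases hlt : v 2 < v (ω - 1) ^ 2
  · have key : ∀ u : ℂ, u ^ 4 = 1 → v (ω - u) = v (ω - 1) := by
      intro u hu
      have h3 : v (1 - u) < v (ω - 1) := by
        rw [Valuation.map_sub_swap]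
        exact lt_of_pow_lt_pow_left₀ 2 zero_le
          ((valuation_pow_four_sub_one_sq_le v h2 hu).trans_lt hlt)
      rw [show ω - u = (ω - 1) + (1 - u) by ring, v.map_add_eq_of_lt_left h3]
    rw [hfac, map_mul, map_mul, map_mul, key (-1) (by norm_num), key _ Complex.I_pow_four,
      key (-Complex.I) (by rw [neg_pow, Complex.I_pow_four]; norm_num)] at hle
    rwa [pow_succ, pow_succ, pow_two]
  · exfalso
    rw [not_lt] at hlt
    have key : ∀ u : ℂ, u ^ 4 = 1 → v (ω - u) ^ 2 ≤ v 2 := by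
      intro u hu
      have h3 := v.map_add (ω - 1) (1 - u)
      rw [sub_add_sub_cancel] at h3
      rcases le_max_iff.1 h3 with h | h
      · exact (pow_le_pow_left' h 2).trans hlt
      · rw [Valuation.map_sub_swap _ 1 u] at h
        exact (pow_le_pow_left' h 2).trans (valuation_pow_four_sub_one_sq_le v h2 hu)
    have h5 : v (ω ^ 4 - 1) ^ 2 ≤ v 2 ^ 4 := by
      rw [hfac, map_mul, map_mul, map_mul, mul_pow, mul_pow, mul_pow,
        show v (2 : ℂ) ^ 4 = v 2 * v 2 * v 2 * v 2 by rw [pow_succ, pow_succ, pow_two]]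
      exact mul_le_mul' (mul_le_mul' (mul_le_mul' hlt (key _ (by norm_num)))
        (key _ Complex.I_pow_four)) (key _ (by rw [neg_pow, Complex.I_pow_four]; norm_num))
    have h6 : v 2 ^ 2 ≤ v 2 ^ 4 := (pow_le_pow_left' hle 2).trans h5
    exact absurd (pow_lt_pow_right_of_lt_one₀ h0 h2 (by norm_num : 2 < 4)) (not_lt.2 h6)

/-- The vectors `(x, y)` whose ratio `y / x` is congruent to `1` modulo `(1 + i)`. -/
def NearRegion (x y : ℂ) : Prop := x ≠ 0 ∧ v (y - x) ^ 2 ≤ v 2 * v x ^ 2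

/-- The vectors `(x, y)` whose ratio `y / x` is a unit at distance at least `v(2)^{1/4}` from `1`.
-/
def FarRegion (x y : ℂ) : Prop := x ≠ 0 ∧ v y = v x ∧ v 2 * v x ^ 4 ≤ v (y - x) ^ 4

variable {v} {x y : ℂ}

theorem NearRegion.smul (h : NearRegion v x y) {c : ℂ} (hc : c ≠ 0) :
    NearRegion v (c * x) (c * y) := by
  refine ⟨mul_ne_zero hc h.1, ?_⟩
  rw [← mul_sub, map_mul, map_mul, mul_pow, mul_pow, mul_left_comm]
  gcongr
  exact h.2

theorem FarRegion.smul (h : FarRegion v x y) {c : ℂ} (hc : c ≠ 0) :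
    FarRegion v (c * x) (c * y) := by
  refine ⟨mul_ne_zero hc h.1, by rw [map_mul, map_mul, h.2.1], ?_⟩
  rw [← mul_sub, map_mul, map_mul, mul_pow, mul_pow, mul_left_comm]
  gcongr
  exact h.2.2

theorem valuation_pos_of_ne_zero (hx : x ≠ 0) : 0 < v x := by
  rwa [zero_lt_iff, Valuation.ne_zero_iff]

theorem NearRegion.sub_lt (h2 : v 2 < 1) (h : NearRegion v x y) : v (y - x) < v x := by
  refine lt_of_pow_lt_pow_left₀ 2 zero_le (h.2.trans_lt ?_)
  exact mul_lt_of_lt_one_left (pow_pos (valuation_pos_of_ne_zero h.1) 2) h2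

theorem NearRegion.valuation_eq (h2 : v 2 < 1) (h : NearRegion v x y) : v y = v x := by
  rw [← sub_add_cancel y x, v.map_add_eq_of_lt_right (h.sub_lt h2)]

theorem NearRegion.ne_zero (h2 : v 2 < 1) (h : NearRegion v x y) : y ≠ 0 := by
  rw [← v.ne_zero_iff, h.valuation_eq h2, v.ne_zero_iff]; exact h.1

theorem FarRegion.ne_zero (h : FarRegion v x y) : y ≠ 0 := by
  rw [← v.ne_zero_iff, h.2.1, v.ne_zero_iff]; exact h.1

theorem NearRegion.swap (h2 : v 2 < 1) (h : NearRegion v x y) : NearRegion v y x := by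
  refine ⟨h.ne_zero h2, ?_⟩
  rw [h.valuation_eq h2, Valuation.map_sub_swap]
  exact h.2

theorem nearRegion_of_pow_four (h2 : v 2 < 1) (hx : x ≠ 0) {u : ℂ} (hu : u ^ 4 = 1) :
    NearRegion v x (u * x) := by
  refine ⟨hx, ?_⟩
  rw [← sub_one_mul, map_mul, mul_pow]
  gcongr
  exact valuation_pow_four_sub_one_sq_le v h2 hu

theorem NearRegion.mul_pow_four (h2 : v 2 < 1) (h : NearRegion v x y) {u : ℂ} (hu : u ^ 4 = 1) :
    NearRegion v x (u * y) := by
  refine ⟨h.1, ?_⟩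
  have h3 := v.map_add (u * (y - x)) (u * x - x)
  rw [show u * (y - x) + (u * x - x) = u * y - x by ring, map_mul,
    valuation_of_pow_eq_one v four_ne_zero hu, one_mul] at h3
  rcases le_max_iff.1 h3 with h4 | h4
  · exact (pow_le_pow_left' h4 2).trans h.2
  · exact (pow_le_pow_left' h4 2).trans (nearRegion_of_pow_four h2 h.1 hu).2

/-- The upper bound that defines the near region is strictly smaller than the lower bound that
defines the far region. -/
theorem valuation_lt_of_near_of_far (h2 : v 2 < 1) (hx : x ≠ 0) {a b : ℂ}
    (ha : v a ^ 2 ≤ v 2 * v x ^ 2) (hb : v 2 * v x ^ 4 ≤ v b ^ 4) : v a < v b := by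
  have h0 := valuation_two_pos v
  have h0x : 0 < v x := valuation_pos_of_ne_zero hx
  refine lt_of_pow_lt_pow_left₀ 4 zero_le (lt_of_lt_of_le ?_ hb)
  calc v a ^ 4 = (v a ^ 2) ^ 2 := by rw [← pow_mul]
    _ ≤ (v 2 * v x ^ 2) ^ 2 := pow_le_pow_left' ha 2
    _ = v 2 ^ 2 * v x ^ 4 := by rw [mul_pow, ← pow_mul]
    _ < v 2 * v x ^ 4 := by
      refine mul_lt_mul_of_pos_right ?_ (pow_pos h0x 4)
      simpa using pow_lt_pow_right_of_lt_one₀ h0 h2 (by norm_num : 1 < 2)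

theorem FarRegion.mul_pow_four (h2 : v 2 < 1) (h : FarRegion v x y) {u : ℂ} (hu : u ^ 4 = 1) :
    FarRegion v x (u * y) := by
  have hvu := valuation_of_pow_eq_one v four_ne_zero hu
  refine ⟨h.1, by rw [map_mul, hvu, one_mul, h.2.1], ?_⟩
  have h3 : v (u * (y - x)) = v (y - x) := by rw [map_mul, hvu, one_mul]
  have h4 : v (u * x - x) < v (u * (y - x)) := by
    rw [h3]
    exact valuation_lt_of_near_of_far h2 h.1 (nearRegion_of_pow_four h2 h.1 hu).2 h.2.2
  rw [show u * y - x = u * (y - x) + (u * x - x) by ring, v.map_add_eq_of_lt_left h4, h3]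
  exact h.2.2

/-- Multiplying the ratio by a root of unity of order not dividing `4` moves the near region into
the far region. -/
theorem NearRegion.mul_root (h2 : v 2 < 1) (h : NearRegion v x y) {ω : ℂ} {m : ℕ} (hm : m ≠ 0)
    (hω : ω ^ m = 1) (h4 : ω ^ 4 ≠ 1) : FarRegion v x (ω * y) := by
  have hvω := valuation_of_pow_eq_one v hm hω
  have hfar : v 2 * v x ^ 4 ≤ v (ω * x - x) ^ 4 := by
    rw [← sub_one_mul, map_mul, mul_pow]
    gcongr
    exact valuation_two_le_pow_four v h2 hm hω h4
  refine ⟨h.1, by rw [map_mul, hvω, one_mul, h.valuation_eq h2], ?_⟩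
  have h5 : v (ω * (y - x)) < v (ω * x - x) := by
    rw [map_mul, hvω, one_mul]
    exact valuation_lt_of_near_of_far h2 h.1 h.2 hfar
  rw [show ω * y - x = ω * (y - x) + (ω * x - x) by ring, v.map_add_eq_of_lt_right h5]
  exact hfar

/-- The Hadamard matrix moves the far region into the near region. -/
theorem FarRegion.hadamard (h2 : v 2 < 1) (h : FarRegion v x y) :
    NearRegion v (x + y) (y - x) := by
  have h0x : 0 < v x := valuation_pos_of_ne_zero h.1
  have h3 : v (2 * x) < v (y - x) := by
    refine valuation_lt_of_near_of_far h2 h.1 ?_ h.2.2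
    rw [map_mul, mul_pow]
    gcongr
    exact pow_le_of_le_one zero_le h2.le two_ne_zero
  have h4 : v (x + y) = v (y - x) := by
    rw [show x + y = (y - x) + 2 * x by ring, v.map_add_eq_of_lt_left h3]
  have h5 : v (y - x) ≤ v x := by
    simpa [h.2.1] using v.map_sub y x
  refine ⟨?_, ?_⟩
  · rw [← v.ne_zero_iff, h4]
    exact (zero_le.trans_lt h3).ne'
  · rw [h4, show y - x - (x + y) = -(2 * x) by ring, Valuation.map_neg, map_mul, mul_pow, sq (v 2),
      mul_assoc]
    refine mul_le_mul_right ?_ _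
    -- `v(2) v(x)^2 ≤ v(y - x)^2`, as the far region bounds `v(2) v(x)^4` by `v(y - x)^4`
    refine le_of_mul_le_mul_right ?_ (pow_pos h0x 2)
    calc v 2 * v x ^ 2 * v x ^ 2 = v 2 * v x ^ 4 := by rw [mul_assoc, ← pow_add]
      _ ≤ v (y - x) ^ 4 := h.2.2
      _ = v (y - x) ^ 2 * v (y - x) ^ 2 := by rw [← pow_add]
      _ ≤ v (y - x) ^ 2 * v x ^ 2 := by gcongr

end Regions

/-! ### Dyadic numbers and dyadic rotations -/

/-- The ring `ℤ[1/2]` of dyadic real numbers. -/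
def dyadic : Subring ℝ where
  carrier := {r | ∃ (k : ℕ) (m : ℤ), 2 ^ k * r = m}
  one_mem' := ⟨0, 1, by simp⟩
  zero_mem' := ⟨0, 0, by simp⟩
  mul_mem' := by
    rintro r s ⟨k, m, h⟩ ⟨l, p, h'⟩
    exact ⟨k + l, m * p, by push_cast; rw [← h, ← h']; ring⟩
  add_mem' := by
    rintro r s ⟨k, m, h⟩ ⟨l, p, h'⟩
    exact ⟨k + l, 2 ^ l * m + 2 ^ k * p, by push_cast; rw [← h, ← h']; ring⟩
  neg_mem' := by
    rintro r ⟨k, m, h⟩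
    exact ⟨k, -m, by push_cast; rw [← h]; ring⟩

theorem half_mem_dyadic : (1 / 2 : ℝ) ∈ dyadic := ⟨1, 1, by norm_num⟩

/-- A sum of three squares equal to a power of `4` has only one non-zero term: modulo `4`, the three
numbers are even as long as the power is not `1`. -/
theorem eq_zero_of_sum_three_sq {k : ℕ} {x y z : ℤ} (h : x ^ 2 + y ^ 2 + z ^ 2 = 4 ^ k) :
    (y = 0 ∧ z = 0) ∨ (x = 0 ∧ z = 0) ∨ (x = 0 ∧ y = 0) := by
  induction k generalizing x y z with
  | zero =>
    rw [pow_zero] at h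
    have hx : x ^ 2 ≤ 1 := by nlinarith [sq_nonneg y, sq_nonneg z]
    have hy : y ^ 2 ≤ 1 := by nlinarith [sq_nonneg x, sq_nonneg z]
    have hz : z ^ 2 ≤ 1 := by nlinarith [sq_nonneg y, sq_nonneg x]
    have hx' := abs_le.1 ((sq_le_one_iff_abs_le_one x).1 hx)
    have hy' := abs_le.1 ((sq_le_one_iff_abs_le_one y).1 hy)
    have hz' := abs_le.1 ((sq_le_one_iff_abs_le_one z).1 hz)
    obtain ⟨hx1, hx2⟩ := hx'
    obtain ⟨hy1, hy2⟩ := hy'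
    obtain ⟨hz1, hz2⟩ := hz'
    interval_cases x <;> interval_cases y <;> interval_cases z <;> simp_all
  | succ k ih =>
    have hsq : ∀ w : ℤ, (∃ a, w = 2 * a ∧ w ^ 2 = 4 * a ^ 2) ∨
        ∃ a, w ^ 2 = 4 * a + 1 := by
      intro w
      rcases Int.even_or_odd' w with ⟨a, rfl | rfl⟩
      · exact Or.inl ⟨a, rfl, by ring⟩
      · exact Or.inr ⟨a ^ 2 + a, by ring⟩
    have h4 : (4 : ℤ) ^ (k + 1) = 4 * 4 ^ k := by rw [pow_succ, mul_comm]
    rcases hsq x with ⟨a, rfl, ha⟩ | ⟨a, ha⟩ <;> rcases hsq y with ⟨b, rfl, hb⟩ | ⟨b, hb⟩ <;>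
      rcases hsq z with ⟨c, rfl, hc⟩ | ⟨c, hc⟩ <;> try omega
    have := ih (x := a) (y := b) (z := c) (by linarith)
    simpa using this

/-- A dyadic point of the unit sphere lies on a coordinate axis. -/
theorem eq_zero_of_dyadic_sphere {a b c : ℝ} (ha : a ∈ dyadic) (hb : b ∈ dyadic) (hc : c ∈ dyadic)
    (h : a ^ 2 + b ^ 2 + c ^ 2 = 1) :
    (b = 0 ∧ c = 0) ∨ (a = 0 ∧ c = 0) ∨ (a = 0 ∧ b = 0) := by
  obtain ⟨k, x, hx⟩ := ha
  obtain ⟨l, y, hy⟩ := hb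
  obtain ⟨m, z, hz⟩ := hc
  have hxyz : (2 ^ (l + m) * x) ^ 2 + (2 ^ (k + m) * y) ^ 2 + (2 ^ (k + l) * z) ^ 2
      = (4 : ℤ) ^ (k + l + m) := by
    have : ((2 ^ (l + m) * x) ^ 2 + (2 ^ (k + m) * y) ^ 2 + (2 ^ (k + l) * z) ^ 2 : ℝ)
        = (4 : ℝ) ^ (k + l + m) := by
      rw [← hx, ← hy, ← hz, show (4 : ℝ) = 2 ^ 2 by norm_num]
      calc _ = (2 ^ (k + l + m)) ^ 2 * (a ^ 2 + b ^ 2 + c ^ 2) := by ring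
        _ = _ := by rw [h, mul_one, ← pow_mul, ← pow_mul, mul_comm]
    exact_mod_cast this
  have key : ∀ {r : ℝ} {p : ℤ} {i j : ℕ}, 2 ^ i * r = p → 2 ^ j * p = 0 → r = 0 := by
    intro r p i j h1 h2
    have h3 : p = 0 := by simpa using h2
    rw [h3] at h1
    simpa using h1
  rcases eq_zero_of_sum_three_sq hxyz with ⟨h1, h2⟩ | ⟨h1, h2⟩ | ⟨h1, h2⟩
  · exact Or.inl ⟨key hy h1, key hz h2⟩
  · exact Or.inr (Or.inl ⟨key hx h1, key hz h2⟩)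
  · exact Or.inr (Or.inr ⟨key hx h1, key hy h2⟩)

theorem sum_sq_col (g : SO3) (j : Fin 3) :
    (g : Matrix (Fin 3) (Fin 3) ℝ) 0 j ^ 2 + (g : Matrix (Fin 3) (Fin 3) ℝ) 1 j ^ 2
      + (g : Matrix (Fin 3) (Fin 3) ℝ) 2 j ^ 2 = 1 := by
  have h : star (g : Matrix (Fin 3) (Fin 3) ℝ) * (g : Matrix (Fin 3) (Fin 3) ℝ) = 1 := g.2.1.1
  have := congrFun (congrFun h j) j
  simp only [Matrix.mul_apply, Fin.sum_univ_three, star_apply, star_trivial,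
    Matrix.one_apply_eq] at this
  linarith

theorem octahedronVertices_finite : octahedronVertices.Finite := by
  have : octahedronVertices ⊆ (Set.range fun i : Fin 3 => (Pi.single i 1 : Fin 3 → ℝ)) ∪
      Set.range fun i : Fin 3 => -(Pi.single i 1 : Fin 3 → ℝ) := by
    rintro v ⟨i, rfl | rfl⟩
    · exact Or.inl ⟨i, rfl⟩
    · exact Or.inr ⟨i, rfl⟩
  exact ((Set.finite_range _).union (Set.finite_range _)).subset this

theorem mem_octahedralGroup_iff (g : SO3) :
    g ∈ octahedralGroup ↔
      ∀ j, (g : Matrix (Fin 3) (Fin 3) ℝ) *ᵥ Pi.single j 1 ∈ octahedronVertices := by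
  constructor
  · intro h j
    have h : (fun v => (g : Matrix (Fin 3) (Fin 3) ℝ) *ᵥ v) '' octahedronVertices
      = octahedronVertices := h
    rw [← h]
    exact ⟨_, ⟨j, Or.inl rfl⟩, rfl⟩
  · intro h
    have hm : Set.MapsTo (fun v => (g : Matrix (Fin 3) (Fin 3) ℝ) *ᵥ v) octahedronVertices
        octahedronVertices := by
      rintro v ⟨j, rfl | rfl⟩
      · exact h j
      · obtain ⟨i, hi | hi⟩ := h j
        · exact ⟨i, Or.inr (by simp only [mulVec_neg, hi])⟩
        · exact ⟨i, Or.inl (by simp only [mulVec_neg, hi, neg_neg])⟩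
    have hinj : Function.Injective fun v => (g : Matrix (Fin 3) (Fin 3) ℝ) *ᵥ v := by
      refine Function.LeftInverse.injective
        (g := fun v => ((g⁻¹ : SO3) : Matrix (Fin 3) (Fin 3) ℝ) *ᵥ v) fun v => ?_
      have h : ((g⁻¹ : SO3) : Matrix (Fin 3) (Fin 3) ℝ) * (g : Matrix (Fin 3) (Fin 3) ℝ) = 1 :=
        congrArg Subtype.val (inv_mul_cancel g)
      simp [Matrix.mulVec_mulVec, h]
    exact Set.eq_of_subset_of_ncard_le hm.image_subset
      (Set.ncard_image_of_injective _ hinj).ge octahedronVertices_finite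

theorem entry_of_mem_octahedralGroup {g : SO3} (hg : g ∈ octahedralGroup) (i j : Fin 3) :
    (g : Matrix (Fin 3) (Fin 3) ℝ) i j = 0 ∨ (g : Matrix (Fin 3) (Fin 3) ℝ) i j = 1 ∨
      (g : Matrix (Fin 3) (Fin 3) ℝ) i j = -1 := by
  have e : (g : Matrix (Fin 3) (Fin 3) ℝ) i j
      = ((g : Matrix (Fin 3) (Fin 3) ℝ) *ᵥ Pi.single j 1) i := by simp
  rw [e]
  obtain ⟨k, hk | hk⟩ := (mem_octahedralGroup_iff g).1 hg j <;> rw [hk] <;>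
    by_cases hik : i = k <;> simp [hik]

/-- The rotations with dyadic coefficients are the rotations of the octahedron. -/
theorem mem_octahedralGroup_of_dyadic {g : SO3}
    (h : ∀ i j, (g : Matrix (Fin 3) (Fin 3) ℝ) i j ∈ dyadic) : g ∈ octahedralGroup := by
  rw [mem_octahedralGroup_iff]
  intro j
  have hs := sum_sq_col g j
  rw [mulVec_single_one]
  rcases eq_zero_of_dyadic_sphere (h 0 j) (h 1 j) (h 2 j) hs with ⟨h1, h2⟩ | ⟨h1, h2⟩ | ⟨h1, h2⟩
  · refine ⟨0, ?_⟩
    have hk : (g : Matrix (Fin 3) (Fin 3) ℝ) 0 j = 1 ∨ (g : Matrix (Fin 3) (Fin 3) ℝ) 0 j = -1 := by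
      simpa [h1, h2] using hs
    rcases hk with h3 | h3
    · left; ext i; fin_cases i <;> simp [h1, h2, h3]
    · right; ext i; fin_cases i <;> simp [h1, h2, h3]
  · refine ⟨1, ?_⟩
    have hk : (g : Matrix (Fin 3) (Fin 3) ℝ) 1 j = 1 ∨ (g : Matrix (Fin 3) (Fin 3) ℝ) 1 j = -1 := by
      simpa [h1, h2] using hs
    rcases hk with h3 | h3
    · left; ext i; fin_cases i <;> simp [h1, h2, h3]
    · right; ext i; fin_cases i <;> simp [h1, h2, h3]
  · refine ⟨2, ?_⟩
    have hk : (g : Matrix (Fin 3) (Fin 3) ℝ) 2 j = 1 ∨ (g : Matrix (Fin 3) (Fin 3) ℝ) 2 j = -1 := by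
      simpa [h1, h2] using hs
    rcases hk with h3 | h3
    · left; ext i; fin_cases i <;> simp [h1, h2, h3]
    · right; ext i; fin_cases i <;> simp [h1, h2, h3]

/-! ### The rings `ℤ[ζ_n, 1/2]` -/

theorem zeta_four : zeta 4 = Complex.I := by
  rw [zeta, show (2 * Real.pi * Complex.I / (4 : ℕ) : ℂ) = Real.pi / 2 * Complex.I by
    push_cast; ring, Complex.exp_pi_div_two_mul_I]

theorem isPrimitiveRoot_zeta {n : ℕ} (hn : n ≠ 0) : IsPrimitiveRoot (zeta n) n :=
  Complex.isPrimitiveRoot_exp n hn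

theorem zeta_mem_ringR (n : ℕ) : zeta n ∈ ringR n := Subring.subset_closure (by simp)

theorem half_mem_ringR (n : ℕ) : (1 / 2 : ℂ) ∈ ringR n := Subring.subset_closure (by simp)

theorem I_mem_ringR : Complex.I ∈ ringR 4 := zeta_four ▸ zeta_mem_ringR 4

theorem zeta_eq_pow {m n : ℕ} (hn : n ≠ 0) (h : m ∣ n) : zeta m = zeta n ^ (n / m) := by
  obtain ⟨k, rfl⟩ := h
  obtain ⟨hm, hk⟩ := mul_ne_zero_iff.1 hn
  rw [zeta, zeta, ← Complex.exp_nat_mul, Nat.mul_div_cancel_left _ (Nat.pos_of_ne_zero hm)]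
  congr 1
  have : (k : ℂ) ≠ 0 := by exact_mod_cast hk
  have : (m : ℂ) ≠ 0 := by exact_mod_cast hm
  push_cast
  field_simp

theorem ringR_le {m n : ℕ} (hn : n ≠ 0) (h : m ∣ n) : ringR m ≤ ringR n := by
  refine Subring.closure_le.2 ?_
  rintro z (rfl | rfl)
  · rw [zeta_eq_pow hn h]
    exact pow_mem (zeta_mem_ringR n) _
  · exact half_mem_ringR n

theorem conj_mem_ringR {n : ℕ} (hn : n ≠ 0) {z : ℂ} (hz : z ∈ ringR n) :
    (starRingEnd ℂ) z ∈ ringR n := by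
  suffices h : ringR n ≤ (ringR n).comap (starRingEnd ℂ) from h hz
  refine Subring.closure_le.2 ?_
  rintro z (rfl | rfl)
  · have h1 : (starRingEnd ℂ) (zeta n) = zeta n ^ (n - 1) := by
      have h2 := zeta_mul_conj n
      have h3 : zeta n * zeta n ^ (n - 1) = 1 := by
        rw [← pow_succ', Nat.sub_add_cancel (Nat.pos_of_ne_zero hn),
          (isPrimitiveRoot_zeta hn).pow_eq_one]
      exact mul_left_cancel₀ ((isPrimitiveRoot_zeta hn).ne_zero hn) (h2.trans h3.symm)
    change (starRingEnd ℂ) (zeta n) ∈ ringR n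
    rw [h1]
    exact pow_mem (zeta_mem_ringR n) _
  · change (starRingEnd ℂ) (1 / 2) ∈ ringR n
    rw [show (starRingEnd ℂ) (1 / 2) = 1 / 2 by simp [Complex.conj_ofNat]]
    exact half_mem_ringR n

theorem mem_U2Over_ringR {n : ℕ} (hn : n ≠ 0) {g : U2}
    (h : ∀ i j, (g : Matrix (Fin 2) (Fin 2) ℂ) i j ∈ ringR n) : g ∈ U2Over (ringR n) := by
  refine ⟨h, fun i j => ?_⟩
  rw [UnitaryGroup.inv_apply, star_apply]
  exact conj_mem_ringR hn (h j i)

/-- The complex numbers with dyadic real and imaginary parts. -/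
def gaussianDyadic : Subring ℂ where
  carrier := {z | z.re ∈ dyadic ∧ z.im ∈ dyadic}
  one_mem' := ⟨one_mem dyadic, zero_mem dyadic⟩
  zero_mem' := ⟨zero_mem dyadic, zero_mem dyadic⟩
  mul_mem' h h' := ⟨sub_mem (mul_mem h.1 h'.1) (mul_mem h.2 h'.2),
    add_mem (mul_mem h.1 h'.2) (mul_mem h.2 h'.1)⟩
  add_mem' h h' := ⟨add_mem h.1 h'.1, add_mem h.2 h'.2⟩
  neg_mem' h := ⟨neg_mem h.1, neg_mem h.2⟩

theorem ringR_four_le : ringR 4 ≤ gaussianDyadic := by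
  refine Subring.closure_le.2 ?_
  rintro z (rfl | rfl)
  · rw [zeta_four]
    exact ⟨zero_mem dyadic, one_mem dyadic⟩
  · refine ⟨?_, ?_⟩
    · simpa using half_mem_dyadic
    · simp

theorem pow_four_eq_one_of_axis {z : ℂ} (h : z.re = 0 ∨ z.im = 0)
    (hz : z.re ^ 2 + z.im ^ 2 = 1) : z ^ 4 = 1 := by
  rcases h with h | h
  · have h1 : z = z.im * Complex.I := by apply Complex.ext <;> simp [h]
    have h2 : (z.im : ℂ) ^ 2 = 1 := by rw [h] at hz; exact_mod_cast (by linarith : z.im ^ 2 = 1)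
    rw [h1, mul_pow, Complex.I_pow_four, show 4 = 2 * 2 from rfl, pow_mul, h2]
    simp
  · have h1 : z = z.re := by apply Complex.ext <;> simp [h]
    have h2 : (z.re : ℂ) ^ 2 = 1 := by rw [h] at hz; exact_mod_cast (by linarith : z.re ^ 2 = 1)
    rw [h1, show 4 = 2 * 2 from rfl, pow_mul, h2]
    simp

/-- The elements of absolute value `1` in `ℤ[i, 1/2]` are the fourth roots of unity. -/
theorem pow_four_eq_one_of_mem_ringR {z : ℂ} (hz : z ∈ ringR 4)
    (h : z.re ^ 2 + z.im ^ 2 = 1) : z ^ 4 = 1 := by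
  have hz := ringR_four_le hz
  refine pow_four_eq_one_of_axis ?_ h
  rcases eq_zero_of_dyadic_sphere hz.1 hz.2 (zero_mem dyadic) (by simpa using h) with
    h | h | h <;> tauto

theorem mem_ringR_of_pow_four {u : ℂ} (hu : u ^ 4 = 1) : u ∈ ringR 4 := by
  rcases eq_of_pow_four_eq_one hu with rfl | rfl | rfl | rfl
  · exact one_mem _
  · exact neg_mem (one_mem _)
  · exact I_mem_ringR
  · exact neg_mem I_mem_ringR

theorem pauli_mem_ringR (j : Fin 3) (a b : Fin 2) : pauli j a b ∈ ringR 4 := by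
  fin_cases j <;> fin_cases a <;> fin_cases b <;>
    simp [pauli, I_mem_ringR]

theorem adU_mem_octahedralGroup {g : U2} (hg : g ∈ cliffordGroup) :
    adU g ∈ octahedralGroup := by
  refine mem_octahedralGroup_of_dyadic fun i j => ?_
  have hmul : ∀ A B : Matrix (Fin 2) (Fin 2) ℂ, (∀ a b, A a b ∈ ringR 4) →
      (∀ a b, B a b ∈ ringR 4) → ∀ a b, (A * B) a b ∈ ringR 4 := fun A B hA hB a b => by
    rw [Matrix.mul_apply]
    exact sum_mem fun c _ => mul_mem (hA a c) (hB c b)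
  have hinv : ∀ a b, (g : Matrix (Fin 2) (Fin 2) ℂ)ᴴ a b ∈ ringR 4 := hg.2
  have h := hmul _ _ (pauli_mem_ringR i) (hmul _ _ (hmul _ _ hg.1 (pauli_mem_ringR j)) hinv)
  refine (ringR_four_le (mul_mem (half_mem_ringR 4) ?_)).1
  rw [Matrix.trace_fin_two]
  exact add_mem (h 0 0) (h 1 1)

/-! ### Matrices in `SU₂(ℂ)` and scalars in `U₂` -/

theorem SU2.toU2_val (s : SU2) :
    (SU2.toU2 s : Matrix (Fin 2) (Fin 2) ℂ) = (s : Matrix (Fin 2) (Fin 2) ℂ) := rfl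

theorem SU2.star_eq_adjugate (s : SU2) :
    star (s : Matrix (Fin 2) (Fin 2) ℂ) = (s : Matrix (Fin 2) (Fin 2) ℂ).adjugate := by
  have h1 : star (s : Matrix (Fin 2) (Fin 2) ℂ) * (s : Matrix (Fin 2) (Fin 2) ℂ) = 1 := s.2.1.1
  have h2 : (s : Matrix (Fin 2) (Fin 2) ℂ).det = 1 := (mem_specialUnitaryGroup_iff.1 s.2).2
  have h3 := Matrix.mul_adjugate (s : Matrix (Fin 2) (Fin 2) ℂ)
  rw [h2, one_smul] at h3
  exact left_inv_eq_right_inv h1 h3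

theorem SU2.apply_one_zero (s : SU2) :
    (s : Matrix (Fin 2) (Fin 2) ℂ) 1 0
      = -(starRingEnd ℂ) ((s : Matrix (Fin 2) (Fin 2) ℂ) 0 1) := by
  have := congrFun (congrFun s.star_eq_adjugate 1) 0
  rw [adjugate_fin_two, star_apply] at this
  simp only [of_apply, cons_val', cons_val_zero, cons_val_one, cons_val_fin_one] at this
  rw [starRingEnd_apply, this, neg_neg]

theorem SU2.apply_one_one (s : SU2) :
    (s : Matrix (Fin 2) (Fin 2) ℂ) 1 1
      = (starRingEnd ℂ) ((s : Matrix (Fin 2) (Fin 2) ℂ) 0 0) := by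
  have := congrFun (congrFun s.star_eq_adjugate 0) 0
  rw [adjugate_fin_two, star_apply] at this
  simp only [of_apply, cons_val', cons_val_zero, cons_val_fin_one] at this
  rw [starRingEnd_apply, this]

/-- The matrix in `SU₂(ℂ)` with first row `(a, b)`. -/
def SU2.mk (a b : ℂ) (h : Complex.normSq a + Complex.normSq b = 1) : SU2 :=
  ⟨!![a, b; -(starRingEnd ℂ) b, (starRingEnd ℂ) a], by
    have h' : a * (starRingEnd ℂ) a + b * (starRingEnd ℂ) b = 1 := by
      rw [Complex.mul_conj, Complex.mul_conj]; exact_mod_cast h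
    rw [mem_specialUnitaryGroup_iff, mem_unitaryGroup_iff, det_fin_two]
    refine ⟨?_, by simpa using h'⟩
    ext i j
    fin_cases i <;> fin_cases j <;>
      simp [Matrix.mul_apply, Fin.sum_univ_two, star_apply] <;>
      first | linear_combination h' | ring⟩

theorem SU2.normSq_add (s : SU2) :
    Complex.normSq ((s : Matrix (Fin 2) (Fin 2) ℂ) 0 0)
      + Complex.normSq ((s : Matrix (Fin 2) (Fin 2) ℂ) 0 1) = 1 := by
  have h2 : (s : Matrix (Fin 2) (Fin 2) ℂ).det = 1 := (mem_specialUnitaryGroup_iff.1 s.2).2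
  rw [det_fin_two, s.apply_one_zero, s.apply_one_one, mul_neg, sub_neg_eq_add, Complex.mul_conj,
    Complex.mul_conj] at h2
  exact_mod_cast h2

theorem SU2.exists_eq_mk (s : SU2) : ∃ a b h, s = SU2.mk a b h := by
  refine ⟨_, _, s.normSq_add, Subtype.ext ?_⟩
  ext i j
  fin_cases i <;> fin_cases j
  · rfl
  · rfl
  · exact s.apply_one_zero
  · exact s.apply_one_one

theorem SU2.mk_congr {a b a' b' : ℂ} {h h'} (ha : a = a') (hb : b = b') :
    SU2.mk a b h = SU2.mk a' b' h' := by
  subst ha hb; rfl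

theorem SU2.mk_mul (a b c d : ℂ) (h h') :
    ∃ h'', SU2.mk a b h * SU2.mk c d h' = SU2.mk (a * c - b * (starRingEnd ℂ) d)
      (a * d + b * (starRingEnd ℂ) c) h'' := by
  have e1 : ((SU2.mk a b h * SU2.mk c d h' : SU2) : Matrix (Fin 2) (Fin 2) ℂ) 0 0
      = a * c - b * (starRingEnd ℂ) d := by
    change ((SU2.mk a b h : Matrix (Fin 2) (Fin 2) ℂ) * SU2.mk c d h') 0 0 = _
    simp [SU2.mk, Matrix.mul_apply, Fin.sum_univ_two]
    ring
  have e2 : ((SU2.mk a b h * SU2.mk c d h' : SU2) : Matrix (Fin 2) (Fin 2) ℂ) 0 1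
      = a * d + b * (starRingEnd ℂ) c := by
    change ((SU2.mk a b h : Matrix (Fin 2) (Fin 2) ℂ) * SU2.mk c d h') 0 1 = _
    simp [SU2.mk, Matrix.mul_apply, Fin.sum_univ_two]
  have hn := (SU2.mk a b h * SU2.mk c d h').normSq_add
  rw [e1, e2] at hn
  refine ⟨hn, ?_⟩
  obtain ⟨p, q, hpq, e⟩ := (SU2.mk a b h * SU2.mk c d h').exists_eq_mk
  rw [e] at e1 e2 ⊢
  exact SU2.mk_congr e1 e2

/-- The scalar matrices in `U₂`. -/
noncomputable def scalarU2 : Circle →* U2 where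
  toFun c := ⟨(c : ℂ) • 1, by
    rw [mem_unitaryGroup_iff, star_smul, star_one, smul_mul_smul_comm, mul_one, RCLike.star_def,
      Complex.mul_conj, Circle.normSq_coe]
    simp⟩
  map_one' := Subtype.ext (by simp)
  map_mul' c d := Subtype.ext (by simp [smul_smul, mul_comm])

theorem scalarU2_mul_val (c : Circle) (g : U2) :
    ((scalarU2 c * g : U2) : Matrix (Fin 2) (Fin 2) ℂ)
      = (c : ℂ) • (g : Matrix (Fin 2) (Fin 2) ℂ) := by
  simp [scalarU2]

theorem scalarU2_comm (c : Circle) (g : U2) : scalarU2 c * g = g * scalarU2 c := by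
  apply Subtype.ext
  simp [scalarU2]

theorem exists_circle_eq {z : ℂ} (hz : Complex.normSq z = 1) : ∃ c : Circle, (c : ℂ) = z := by
  refine ⟨⟨z, mem_sphere_zero_iff_norm.2 ?_⟩, rfl⟩
  rw [Complex.normSq_eq_norm_sq] at hz
  exact (pow_eq_one_iff_of_nonneg (norm_nonneg z) two_ne_zero).1 hz

theorem exists_circle_sq_eq {z : ℂ} (hz : Complex.normSq z = 1) :
    ∃ c : Circle, (c : ℂ) ^ 2 = z := by
  obtain ⟨w, rfl⟩ := IsSquare.exists_sq z (IsAlgClosed.exists_eq_mul_self z)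
  rw [map_pow] at hz
  obtain ⟨c, rfl⟩ := exists_circle_eq
    ((pow_eq_one_iff_of_nonneg (Complex.normSq_nonneg w) two_ne_zero).1 hz)
  exact ⟨c, rfl⟩

theorem det_normSq (g : U2) : Complex.normSq (g : Matrix (Fin 2) (Fin 2) ℂ).det = 1 := by
  have h : star (g : Matrix (Fin 2) (Fin 2) ℂ) * (g : Matrix (Fin 2) (Fin 2) ℂ) = 1 := g.2.1
  have h2 := congrArg Matrix.det h
  rw [det_mul, star_eq_conjTranspose, det_conjTranspose, det_one, mul_comm, RCLike.star_def,
    Complex.mul_conj] at h2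
  exact_mod_cast h2

/-- Every unitary matrix is a scalar times a special unitary matrix. -/
theorem exists_scalar_mul (g : U2) : ∃ (c : Circle) (s : SU2), g = scalarU2 c * SU2.toU2 s ∧
    (c : ℂ) ^ 2 = (g : Matrix (Fin 2) (Fin 2) ℂ).det := by
  obtain ⟨c, hc⟩ := exists_circle_sq_eq (det_normSq g)
  have hs : (scalarU2 c⁻¹ * g : U2).1 ∈ specialUnitaryGroup (Fin 2) ℂ := by
    rw [mem_specialUnitaryGroup_iff]
    refine ⟨(scalarU2 c⁻¹ * g : U2).2, ?_⟩
    rw [scalarU2_mul_val, det_smul, Fintype.card_fin, ← hc, ← mul_pow, ← Circle.coe_mul,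
      inv_mul_cancel, Circle.coe_one, one_pow]
  refine ⟨c, ⟨_, hs⟩, ?_, hc⟩
  have : SU2.toU2 ⟨_, hs⟩ = scalarU2 c⁻¹ * g := rfl
  rw [this, map_inv, mul_inv_cancel_left]

theorem adU_scalar (c : Circle) : adU (scalarU2 c) = 1 := by
  apply Subtype.ext
  change conjMatrix (scalarU2 c) = 1
  rw [← conjMatrix_one]
  ext i j
  have hc : (starRingEnd ℂ) (c : ℂ) * c = 1 := by
    rw [mul_comm, Complex.mul_conj, Circle.normSq_coe]; simp
  simp [conjMatrix, scalarU2, smul_smul, hc]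

theorem exists_scalar_of_adU_eq {g h : U2} (e : adU g = adU h) :
    ∃ c : Circle, g = scalarU2 c * h := by
  have e1 : adU (g * h⁻¹) = 1 := by rw [map_mul, map_inv, e, mul_inv_cancel]
  set k := g * h⁻¹ with hk
  have e2 : conjMatrix k = 1 := congrArg Subtype.val e1
  have hk1 : (k : Matrix (Fin 2) (Fin 2) ℂ)ᴴ * (k : Matrix (Fin 2) (Fin 2) ℂ) = 1 := k.2.1
  have hcomm : ∀ j, (k : Matrix (Fin 2) (Fin 2) ℂ) * pauli j
      = pauli j * (k : Matrix (Fin 2) (Fin 2) ℂ) := by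
    intro j
    have h1 := conj_pauli k j
    rw [e2] at h1
    have h2 : ∑ i, (((1 : Matrix (Fin 3) (Fin 3) ℝ) i j : ℝ) : ℂ) • pauli i = pauli j := by
      rw [Finset.sum_eq_single j] <;> simp +contextual
    rw [h2] at h1
    calc _ = ((k : Matrix (Fin 2) (Fin 2) ℂ) * pauli j * (k : Matrix (Fin 2) (Fin 2) ℂ)ᴴ) *
          (k : Matrix (Fin 2) (Fin 2) ℂ) := by rw [mul_assoc _ _ (k : Matrix (Fin 2) (Fin 2) ℂ),
            hk1, mul_one]
      _ = _ := by rw [h1]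
  have h0 := hcomm 0
  have h2 := hcomm 2
  have p1 := congrFun (congrFun h2 0) 1
  have p2 := congrFun (congrFun h2 1) 0
  have p3 := congrFun (congrFun h0 0) 1
  simp [pauli, Matrix.mul_apply, Fin.sum_univ_two] at p1 p2 p3
  have q1 : (k : Matrix (Fin 2) (Fin 2) ℂ) 0 1 = 0 := by linear_combination (-1 / 2 : ℂ) * p1
  have q2 : (k : Matrix (Fin 2) (Fin 2) ℂ) 1 0 = 0 := by linear_combination (1 / 2 : ℂ) * p2
  have hn : Complex.normSq ((k : Matrix (Fin 2) (Fin 2) ℂ) 0 0) = 1 := by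
    have := congrFun (congrFun hk1 0) 0
    simp [Matrix.mul_apply, Fin.sum_univ_two, q2] at this
    rw [mul_comm, Complex.mul_conj] at this
    exact_mod_cast this
  obtain ⟨c, hc⟩ := exists_circle_eq hn
  refine ⟨c, ?_⟩
  have : k = scalarU2 c := by
    apply Subtype.ext
    ext i j
    fin_cases i <;> fin_cases j <;> simp [scalarU2, hc, q1, q2, p3]
  rw [← this, hk, inv_mul_cancel_right]

/-! ### The binary octahedral group in coordinates -/

section Coordinates

variable (a b : ℂ) (h : Complex.normSq a + Complex.normSq b = 1)

theorem conjMatrix_mk_two_two : ((Ad (SU2.mk a b h) : SO3) : Matrix (Fin 3) (Fin 3) ℝ) 2 2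
    = Complex.normSq a - Complex.normSq b := by
  simp [Ad, adU, SU2.toU2_val, conjMatrix, pauliCoord, pauli, trace_fin_two, SU2.mk,
    Matrix.mul_apply, Fin.sum_univ_two, Complex.normSq_apply]
  ring

theorem conjMatrix_mk_zero_two : ((Ad (SU2.mk a b h) : SO3) : Matrix (Fin 3) (Fin 3) ℝ) 0 2
    = -(2 * (a * b)).re := by
  simp [Ad, adU, SU2.toU2_val, conjMatrix, pauliCoord, pauli, trace_fin_two, SU2.mk,
    Matrix.mul_apply, Fin.sum_univ_two]
  ring

theorem conjMatrix_mk_two_zero : ((Ad (SU2.mk a b h) : SO3) : Matrix (Fin 3) (Fin 3) ℝ) 2 0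
    = (2 * (a * (starRingEnd ℂ) b)).re := by
  simp [Ad, adU, SU2.toU2_val, conjMatrix, pauliCoord, pauli, trace_fin_two, SU2.mk,
    Matrix.mul_apply, Fin.sum_univ_two]
  ring

theorem conjMatrix_mk_two_one : ((Ad (SU2.mk a b h) : SO3) : Matrix (Fin 3) (Fin 3) ℝ) 2 1
    = (2 * (a * (starRingEnd ℂ) b)).im := by
  simp [Ad, adU, SU2.toU2_val, conjMatrix, pauliCoord, pauli, trace_fin_two, SU2.mk,
    Matrix.mul_apply, Fin.sum_univ_two]
  ring

theorem conjMatrix_mk_zero_zero : ((Ad (SU2.mk a b h) : SO3) : Matrix (Fin 3) (Fin 3) ℝ) 0 0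
    = (a ^ 2 - b ^ 2).re := by
  simp [Ad, adU, SU2.toU2_val, conjMatrix, pauliCoord, pauli, trace_fin_two, SU2.mk,
    Matrix.mul_apply, Fin.sum_univ_two, sq]
  ring

end Coordinates

theorem pow_four_eq_one_of_entries {z : ℂ} (hr : z.re = 0 ∨ z.re = 1 ∨ z.re = -1)
    (hn : Complex.normSq z = 1) : z ^ 4 = 1 := by
  rw [Complex.normSq_apply] at hn
  refine pow_four_eq_one_of_axis ?_ (by linarith)
  rcases hr with h | h | h
  · exact Or.inl h
  all_goals
    right
    rw [h] at hn
    nlinarith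

/-- An element of the binary octahedral group is either monomial, with eighth roots of unity as
entries, or all its entries have absolute value `1 / √2` and their ratios are fourth roots of
unity. -/
theorem E48_cases {a b : ℂ} {h} (hs : SU2.mk a b h ∈ E48) :
    (b = 0 ∧ a ^ 8 = 1) ∨ (a = 0 ∧ b ^ 8 = 1) ∨ (a ≠ 0 ∧ Complex.normSq a = 1 / 2 ∧
      ∃ u w : ℂ, u ^ 4 = 1 ∧ w ^ 4 = 1 ∧ b = u * a ∧ (starRingEnd ℂ) a = w * a) := by
  have he := entry_of_mem_octahedralGroup (g := Ad (SU2.mk a b h)) hs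
  have h22 := he 2 2
  have h00 := he 0 0
  have h02 := he 0 2
  have h20 := he 2 0
  rw [conjMatrix_mk_two_two] at h22
  rw [conjMatrix_mk_zero_zero] at h00
  rw [conjMatrix_mk_zero_two] at h02
  rw [conjMatrix_mk_two_zero] at h20
  rcases h22 with h22 | h22 | h22
  · right; right
    have ha : Complex.normSq a = 1 / 2 := by linarith
    have hb : Complex.normSq b = 1 / 2 := by linarith
    have ha0 : a ≠ 0 := by rintro rfl; simp at ha
    have ha' : a * (starRingEnd ℂ) a = 1 / 2 := by
      rw [Complex.mul_conj, ha]; norm_num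
    have hp : (2 * (a * b)) ^ 4 = 1 := by
      refine pow_four_eq_one_of_entries ?_ ?_
      · rcases h02 with h | h | h
        · left; linarith
        · right; right; linarith
        · right; left; linarith
      · rw [map_mul, map_mul, ha, hb]; norm_num [Complex.normSq_apply]
    have hq : (2 * (a * (starRingEnd ℂ) b)) ^ 4 = 1 := by
      refine pow_four_eq_one_of_entries h20 ?_
      rw [map_mul, map_mul, Complex.normSq_conj, ha, hb]; norm_num [Complex.normSq_apply]
    have hu : (2 * ((starRingEnd ℂ) a * b)) ^ 4 = 1 := by
      have := congrArg (starRingEnd ℂ) hq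
      simpa [Complex.conj_ofNat] using this
    refine ⟨ha0, ha, 2 * ((starRingEnd ℂ) a * b), (2 * (a * b)) ^ 3 * (2 * ((starRingEnd ℂ) a * b)),
      hu, ?_, ?_, ?_⟩
    · rw [mul_pow, hu, ← pow_mul, mul_comm 3 4, pow_mul, hp]; norm_num
    · linear_combination (-2 * b) * ha'
    · calc (starRingEnd ℂ) a = (2 * (a * b)) ^ 4 * (starRingEnd ℂ) a := by rw [hp, one_mul]
        _ = _ := by ring
  · left
    have hb : Complex.normSq b = 0 := by linarith
    have ha : Complex.normSq a = 1 := by linarith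
    obtain rfl := Complex.normSq_eq_zero.1 hb
    refine ⟨rfl, ?_⟩
    rw [show 8 = 2 * 4 from rfl, pow_mul]
    refine pow_four_eq_one_of_entries (by simpa using h00) (by rw [map_pow, ha, one_pow])
  · right; left
    have hb : Complex.normSq b = 1 := by linarith
    have ha : Complex.normSq a = 0 := by linarith
    obtain rfl := Complex.normSq_eq_zero.1 ha
    refine ⟨rfl, ?_⟩
    have : (-b ^ 2) ^ 4 = 1 :=
      pow_four_eq_one_of_entries (by simpa using h00)
        (by rw [Complex.normSq_neg, map_pow, hb, one_pow])
    rw [← this]; ring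

theorem mem_E48_of_clifford {s : SU2} {c : Circle}
    (h : scalarU2 c * SU2.toU2 s ∈ cliffordGroup) : s ∈ E48 := by
  have := adU_mem_octahedralGroup h
  rwa [map_mul, adU_scalar, one_mul] at this

theorem scalar_mul_mk_mem {n : ℕ} (hn : n ≠ 0) {a b : ℂ} {h} {c : Circle}
    (h1 : (c : ℂ) * a ∈ ringR n) (h2 : (c : ℂ) * b ∈ ringR n)
    (h3 : (c : ℂ) * (starRingEnd ℂ) b ∈ ringR n) (h4 : (c : ℂ) * (starRingEnd ℂ) a ∈ ringR n) :
    scalarU2 c * SU2.toU2 (SU2.mk a b h) ∈ U2Over (ringR n) := by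
  refine mem_U2Over_ringR hn fun i j => ?_
  rw [scalarU2_mul_val, SU2.toU2_val]
  fin_cases i <;> fin_cases j
  · exact h1
  · exact h2
  · simpa [SU2.mk] using h3
  · exact h4

theorem exists_scalar_mul_mem_clifford {s : SU2} (hs : s ∈ E48) :
    ∃ c : Circle, scalarU2 c * SU2.toU2 s ∈ cliffordGroup := by
  obtain ⟨a, b, h, rfl⟩ := s.exists_eq_mk
  have h4 : (4 : ℕ) ≠ 0 := by norm_num
  rcases E48_cases hs with ⟨rfl, ha⟩ | ⟨rfl, hb⟩ | ⟨ha0, ha, u, w, hu, hw, rfl, haw⟩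
  · have hn : Complex.normSq ((starRingEnd ℂ) a) = 1 := by
      rw [Complex.normSq_conj]; simpa using h
    obtain ⟨c, hc⟩ := exists_circle_eq hn
    have h1 : (starRingEnd ℂ) a * a = 1 := by
      rw [mul_comm, Complex.mul_conj, ← Complex.normSq_conj, hn, Complex.ofReal_one]
    refine ⟨c, scalar_mul_mk_mem h4 ?_ ?_ ?_ ?_⟩ <;> rw [hc]
    · rw [h1]; exact one_mem _
    · simp
    · simp
    · refine mem_ringR_of_pow_four ?_
      rw [← sq, ← pow_mul, ← map_pow, ha, map_one]
  · have hn : Complex.normSq ((starRingEnd ℂ) b) = 1 := by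
      rw [Complex.normSq_conj]; simpa using h
    obtain ⟨c, hc⟩ := exists_circle_eq hn
    have h1 : (starRingEnd ℂ) b * b = 1 := by
      rw [mul_comm, Complex.mul_conj, ← Complex.normSq_conj, hn, Complex.ofReal_one]
    refine ⟨c, scalar_mul_mk_mem h4 ?_ ?_ ?_ ?_⟩ <;> rw [hc]
    · simp
    · rw [h1]; exact one_mem _
    · refine mem_ringR_of_pow_four ?_
      rw [← sq, ← pow_mul, ← map_pow, hb, map_one]
    · simp
  · -- the scalar turns the entry `a` of absolute value `1 / √2` into `(1 + i) / 2`
    have hn : Complex.normSq ((1 + Complex.I) * (starRingEnd ℂ) a) = 1 := by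
      rw [map_mul, Complex.normSq_conj, ha]; norm_num [Complex.normSq_apply]
    obtain ⟨c, hc⟩ := exists_circle_eq hn
    have hc0 : (1 + Complex.I) * (1 / 2) ∈ ringR 4 :=
      mul_mem (add_mem (one_mem _) I_mem_ringR) (half_mem_ringR 4)
    have h1 : (c : ℂ) * a = (1 + Complex.I) * (1 / 2) := by
      rw [hc, mul_assoc, mul_comm _ a, Complex.mul_conj, ha]; norm_num
    have hu' : ((starRingEnd ℂ) u) ^ 4 = 1 := by rw [← map_pow, hu, map_one]
    refine ⟨c, scalar_mul_mk_mem h4 ?_ ?_ ?_ ?_⟩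
    · rw [h1]; exact hc0
    · rw [mul_left_comm, h1]; exact mul_mem (mem_ringR_of_pow_four hu) hc0
    · rw [map_mul, haw, mul_left_comm, mul_left_comm (c : ℂ), h1]
      exact mul_mem (mem_ringR_of_pow_four hu') (mul_mem (mem_ringR_of_pow_four hw) hc0)
    · rw [haw, mul_left_comm, h1]; exact mul_mem (mem_ringR_of_pow_four hw) hc0

/-! ### The group `ℋ` and its index-two subgroup -/

theorem mem_groupH_iff {n : ℕ} {h : SU2} :
    h ∈ groupH n ↔ ∃ c : Circle, scalarU2 c * SU2.toU2 h ∈ groupG n := by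
  constructor
  · rintro ⟨g, hg, e⟩
    obtain ⟨c, rfl⟩ := exists_scalar_of_adU_eq (g := g) (h := SU2.toU2 h) e
    exact ⟨c, hg⟩
  · rintro ⟨c, hc⟩
    exact ⟨_, hc, by rw [map_mul, adU_scalar, one_mul]; rfl⟩

theorem clifford_le_groupG (n : ℕ) : cliffordGroup ≤ groupG n :=
  fun _ hg => Subgroup.subset_closure (Or.inl hg)

theorem gateT_mem_groupG (n : ℕ) : gateT n ∈ groupG n := Subgroup.subset_closure (Or.inr rfl)

theorem E48_le_groupH (n : ℕ) : E48 ≤ groupH n := fun _ hs =>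
  have ⟨c, hc⟩ := exists_scalar_mul_mem_clifford hs
  mem_groupH_iff.2 ⟨c, clifford_le_groupG n hc⟩

theorem groupSG_le_groupH (n : ℕ) : groupSG n ≤ groupH n := fun h hh =>
  mem_groupH_iff.2 ⟨1, by rw [map_one, one_mul]; exact hh.1⟩

theorem gateT_pow_val (n k : ℕ) :
    ((gateT n ^ k : U2) : Matrix (Fin 2) (Fin 2) ℂ) = !![1, 0; 0, zeta n ^ k] := by
  induction k with
  | zero => ext i j; fin_cases i <;> fin_cases j <;> simp
  | succ k ih =>
    rw [pow_succ, UnitaryGroup.mul_val, ih]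
    ext i j
    fin_cases i <;> fin_cases j <;> simp [gateT, Matrix.mul_apply, pow_succ]

/-- The diagonal matrix `diag(d, d⁻¹)` is, up to the scalar `d`, the power of `T_n` with entry
`d⁻²`. -/
theorem scalar_mul_diag {n k : ℕ} {d : ℂ} {h} {c : Circle} (hc : (c : ℂ) = (starRingEnd ℂ) d)
    (hd : ((starRingEnd ℂ) d) ^ 2 = zeta n ^ k) :
    scalarU2 c * SU2.toU2 (SU2.mk d 0 h) = gateT n ^ k := by
  apply Subtype.ext
  have h1 : (starRingEnd ℂ) d * d = 1 := by
    rw [mul_comm, Complex.mul_conj]; exact_mod_cast (by simpa using h)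
  rw [scalarU2_mul_val, SU2.toU2_val, gateT_pow_val, hc, ← hd]
  ext i j
  fin_cases i <;> fin_cases j <;> simp [SU2.mk, h1, sq]

theorem diag_mem_groupH {n : ℕ} (hn : n ≠ 0) {d : ℂ} {h} (hd : d ^ (2 * n) = 1) :
    SU2.mk d 0 h ∈ groupH n := by
  have : NeZero n := ⟨hn⟩
  obtain ⟨c, hc⟩ := exists_circle_eq (z := (starRingEnd ℂ) d)
    (by rw [Complex.normSq_conj]; simpa using h)
  obtain ⟨k, -, hk⟩ := (isPrimitiveRoot_zeta hn).eq_pow_of_pow_eq_one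
    (ξ := (starRingEnd ℂ) d ^ 2) (by rw [← pow_mul, ← map_pow, hd, map_one])
  refine mem_groupH_iff.2 ⟨c, ?_⟩
  rw [scalar_mul_diag hc hk.symm]
  exact pow_mem (gateT_mem_groupG n) k

/-- `ℋ` is generated by the binary octahedral group and any lift `diag(d, d⁻¹)` of `T_n`. -/
theorem groupH_le {n : ℕ} {K : Subgroup SU2} (hE : E48 ≤ K) {d : ℂ} {h}
    (hd : ((starRingEnd ℂ) d) ^ 2 = zeta n) (hK : SU2.mk d 0 h ∈ K) : groupH n ≤ K := by
  have hG : groupG n ≤ (K.map Ad).comap adU := by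
    refine (Subgroup.closure_le _).2 ?_
    rintro g (hg | rfl)
    · obtain ⟨c, s, rfl, -⟩ := exists_scalar_mul g
      refine ⟨s, hE (mem_E48_of_clifford hg), ?_⟩
      rw [map_mul, adU_scalar, one_mul]; rfl
    · refine ⟨_, hK, ?_⟩
      obtain ⟨c, hc⟩ := exists_circle_eq (z := (starRingEnd ℂ) d)
        (by rw [Complex.normSq_conj]; simpa using h)
      rw [← pow_one (gateT n), ← scalar_mul_diag (h := h) hc (by rw [hd, pow_one]), map_mul,
        adU_scalar, one_mul]
      rfl
  rintro s ⟨g, hg, e⟩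
  obtain ⟨k, hk, e'⟩ := hG hg
  have h1 : s * k⁻¹ ∈ E48 := by
    change Ad (s * k⁻¹) ∈ octahedralGroup
    rw [map_mul, map_inv, e', ← e, mul_inv_cancel]
    exact one_mem _
  simpa using mul_mem (hE h1) hk

theorem flip_mem_clifford : SU2.toU2 (SU2.mk 0 1 (by simp)) ∈ cliffordGroup := by
  rw [← one_mul (SU2.toU2 _), ← map_one scalarU2]
  refine scalar_mul_mk_mem (by norm_num) ?_ ?_ ?_ ?_ <;> simp

theorem flip_mem_E48 : SU2.mk 0 1 (by simp) ∈ E48 :=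
  mem_E48_of_clifford (c := 1) (by rw [map_one, one_mul]; exact flip_mem_clifford)

theorem scalar_mem_groupG {n : ℕ} (hn : n ≠ 0) {c : Circle} (hc : c ^ n = 1) :
    scalarU2 c ∈ groupG n := by
  have : NeZero n := ⟨hn⟩
  obtain ⟨k, -, hk⟩ := (isPrimitiveRoot_zeta hn).eq_pow_of_pow_eq_one
    (ξ := (c : ℂ)) (by rw [← Circle.coe_pow, hc, Circle.coe_one])
  have hX := clifford_le_groupG n flip_mem_clifford
  have hT := pow_mem (gateT_mem_groupG n) k
  convert mul_mem hT (mul_mem (mul_mem hX hT) (inv_mem hX)) using 1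
  rw [← mul_assoc, eq_mul_inv_iff_mul_eq]
  apply Subtype.ext
  rw [UnitaryGroup.mul_val, UnitaryGroup.mul_val, UnitaryGroup.mul_val, gateT_pow_val, SU2.toU2_val]
  ext i j
  fin_cases i <;> fin_cases j <;> simp [SU2.mk, scalarU2, hk, Matrix.mul_apply]

theorem groupG_le_U2Over {n : ℕ} (hn : n ≠ 0) (h4 : 4 ∣ n) : groupG n ≤ U2Over (ringR n) := by
  refine (Subgroup.closure_le _).2 ?_
  rintro g (hg | rfl)
  · exact mem_U2Over_ringR hn fun i j => ringR_le hn h4 (hg.1 i j)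
  · refine mem_U2Over_ringR hn fun i j => ?_
    fin_cases i <;> fin_cases j <;> simp [gateT, zeta_mem_ringR]

theorem det_pow_eq_one {n : ℕ} (hn : n ≠ 0) (h4 : 4 ∣ n) {g : U2} (hg : g ∈ groupG n) :
    (g : Matrix (Fin 2) (Fin 2) ℂ).det ^ n = 1 := by
  let f : U2 →* ℂ := (powMonoidHom n).comp (detMonoidHom.comp (unitaryGroup (Fin 2) ℂ).subtype)
  suffices h : groupG n ≤ f.ker from h hg
  refine (Subgroup.closure_le _).2 ?_
  rintro g (hg' | rfl)
  · change (g : Matrix (Fin 2) (Fin 2) ℂ).det ^ n = 1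
    obtain ⟨k, rfl⟩ := h4
    rw [pow_mul, pow_four_eq_one_of_mem_ringR, one_pow]
    · rw [det_fin_two]
      exact sub_mem (mul_mem (hg'.1 0 0) (hg'.1 1 1)) (mul_mem (hg'.1 0 1) (hg'.1 1 0))
    · rw [← det_normSq g, Complex.normSq_apply]; ring
  · change (gateT n : Matrix (Fin 2) (Fin 2) ℂ).det ^ n = 1
    rw [← (isPrimitiveRoot_zeta hn).pow_eq_one]
    simp [gateT, det_fin_two]

/-- For even `n`, the field `ℚ(ζ_n)` has degree `φ(n) < φ(2n)`, so it does not contain `ζ_{2n}`. -/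
theorem zeta_two_mul_notMem {n : ℕ} (hn : n ≠ 0) (h2 : 2 ∣ n) : zeta (2 * n) ∉ ringR n := by
  intro h
  have hp := isPrimitiveRoot_zeta hn
  have hp2 := isPrimitiveRoot_zeta (mul_ne_zero two_ne_zero hn)
  have hint : IsIntegral ℚ (zeta n) := (hp.isIntegral (Nat.pos_of_ne_zero hn)).tower_top
  have hle : ringR n ≤ (IntermediateField.adjoin ℚ {zeta n}).toSubfield.toSubring := by
    refine Subring.closure_le.2 ?_
    rintro z (rfl | rfl)
    · exact IntermediateField.mem_adjoin_simple_self ℚ _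
    · change (1 / 2 : ℂ) ∈ IntermediateField.adjoin ℚ {zeta n}
      exact div_mem (one_mem _) (ofNat_mem _ 2)
  have hfin := IntermediateField.adjoin.finiteDimensional hint
  let z : IntermediateField.adjoin ℚ {zeta n} := ⟨zeta (2 * n), hle h⟩
  have hz : minpoly ℚ (zeta (2 * n)) = minpoly ℚ z :=
    minpoly.algebraMap_eq (FaithfulSMul.algebraMap_injective _ ℂ) z
  have h1 := minpoly.natDegree_le (A := ℚ) z
  rw [IntermediateField.adjoin.finrank hint, ← hz,
    ← Polynomial.cyclotomic_eq_minpoly_rat hp (Nat.pos_of_ne_zero hn),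
    ← Polynomial.cyclotomic_eq_minpoly_rat hp2 (by omega), Polynomial.natDegree_cyclotomic,
    Polynomial.natDegree_cyclotomic, Nat.totient_mul_of_prime_of_dvd Nat.prime_two h2] at h1
  have := Nat.totient_pos.2 (Nat.pos_of_ne_zero hn)
  omega

theorem zeta_normSq (n : ℕ) : Complex.normSq (zeta n) = 1 := by
  have := zeta_mul_conj n
  rw [Complex.mul_conj] at this
  exact_mod_cast this

theorem zeta_two_mul_sq {n : ℕ} (hn : n ≠ 0) : zeta (2 * n) ^ 2 = zeta n := by
  rw [zeta_eq_pow (m := n) (n := 2 * n) (mul_ne_zero two_ne_zero hn) ⟨2, mul_comm _ _⟩,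
    Nat.mul_div_cancel _ (Nat.pos_of_ne_zero hn)]

theorem zeta_two_mul_pow {n : ℕ} (hn : n ≠ 0) : zeta (2 * n) ^ n = -1 := by
  have hp := isPrimitiveRoot_zeta (mul_ne_zero two_ne_zero hn)
  have h1 : zeta (2 * n) ^ n * zeta (2 * n) ^ n = 1 := by
    rw [← pow_add, ← two_mul, hp.pow_eq_one]
  refine (mul_self_eq_one_iff.1 h1).resolve_left fun h => ?_
  have := Nat.le_of_dvd (Nat.pos_of_ne_zero hn) (hp.dvd_of_pow_eq_one n h)
  omega

theorem mem_groupSG_of_scalar {n : ℕ} (hn : n ≠ 0) (h4 : 4 ∣ n) {c : Circle} (hc : c ^ n = 1)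
    {s : SU2} (h : scalarU2 c * SU2.toU2 s ∈ groupG n) : s ∈ groupSG n := by
  have hs : SU2.toU2 s ∈ groupG n := by
    simpa using mul_mem (inv_mem (scalar_mem_groupG hn hc)) h
  exact ⟨hs, groupG_le_U2Over hn h4 hs⟩

/-- An element of `ℋ` is `λ⁻¹ g` with `g ∈ 𝒢_n`, where `λ ^ 2 = det g` is an `n`-th root of unity.
If `λ` is one too, the element lies in `S𝒢_n`, and otherwise its product with
`diag(ζ_{2n}⁻¹, ζ_{2n})` does. -/
theorem relIndex_groupSG {n : ℕ} (hn : n ≠ 0) (h4 : 4 ∣ n) :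
    (groupSG n).relIndex (groupH n) = 2 := by
  have h2n := isPrimitiveRoot_zeta (mul_ne_zero two_ne_zero hn)
  obtain ⟨z, hz⟩ := exists_circle_eq (zeta_normSq (2 * n))
  rw [Subgroup.relIndex_eq_two_iff_exists_notMem_and]
  refine ⟨SU2.mk ((starRingEnd ℂ) (zeta (2 * n))) 0
    (by rw [Complex.normSq_conj, zeta_normSq]; simp), diag_mem_groupH hn ?_, ?_, ?_⟩
  · rw [← map_pow, h2n.pow_eq_one, map_one]
  · intro h
    refine zeta_two_mul_notMem hn (dvd_trans (by norm_num) h4) ?_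
    have := h.2.1 1 1
    simpa [SU2.toU2_val, SU2.mk] using this
  · intro b hb
    obtain ⟨c, hc⟩ := mem_groupH_iff.1 hb
    have hdet := det_pow_eq_one hn h4 hc
    rw [scalarU2_mul_val, det_smul, Fintype.card_fin, SU2.toU2_val,
      (mem_specialUnitaryGroup_iff.1 b.2).2, mul_one, ← pow_mul, mul_comm, pow_mul,
      sq_eq_one_iff] at hdet
    rcases hdet with hdet | hdet
    · right
      refine mem_groupSG_of_scalar hn h4 (c := c) (Circle.ext ?_) hc
      rw [Circle.coe_pow, hdet, Circle.coe_one]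
    · left
      refine mem_groupSG_of_scalar hn h4 (c := c * z) (Circle.ext ?_) ?_
      · rw [Circle.coe_pow, Circle.coe_mul, mul_pow, hdet, hz, zeta_two_mul_pow hn]
        norm_num
      · have hT := scalar_mul_diag (n := n) (k := 1) (d := (starRingEnd ℂ) (zeta (2 * n)))
          (h := by rw [Complex.normSq_conj, zeta_normSq]; simp) (c := z)
          (by rw [hz, Complex.conj_conj])
          (by rw [Complex.conj_conj, zeta_two_mul_sq hn, pow_one])
        rw [map_mul, map_mul, mul_assoc, ← mul_assoc (scalarU2 z), scalarU2_comm z, mul_assoc,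
          ← mul_assoc, hT, pow_one]
        exact mul_mem hc (gateT_mem_groupG n)

/-! ### Homomorphisms out of quaternion groups -/

section Quaternion

open QuaternionGroup

theorem quaternionGroup_xa_conj_a {n : ℕ} (j i : ZMod (2 * n)) :
    xa j * a i * (xa j)⁻¹ = (a i)⁻¹ := by
  rw [mul_inv_eq_iff_eq_mul, eq_inv_mul_iff_mul_eq]
  simp

variable {G : Type*} [Group G] {n : ℕ} [NeZero n]

theorem pow_zmod_val_add {m : ℕ} [NeZero m] {A : G} (hA : A ^ m = 1) (i j : ZMod m) :
    A ^ (i + j).val = A ^ i.val * A ^ j.val := by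
  rw [ZMod.val_add, ← pow_add, ← pow_eq_pow_mod _ hA]

theorem pow_zmod_val_sub {m : ℕ} [NeZero m] {A : G} (hA : A ^ m = 1) (i j : ZMod m) :
    A ^ (i - j).val = (A ^ j.val)⁻¹ * A ^ i.val := by
  rw [eq_inv_mul_iff_mul_eq, ← pow_zmod_val_add hA, add_sub_cancel]

theorem pow_zmod_val_natCast {m : ℕ} [NeZero m] {A : G} (hA : A ^ m = 1) (k : ℕ) :
    A ^ (k : ZMod m).val = A ^ k := by
  rw [ZMod.val_natCast, ← pow_eq_pow_mod _ hA]

/-- The homomorphism from the quaternion group of order `4n` defined by two elements that satisfy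
its relations. -/
def quaternionLift (A X : G) (hA : A ^ (2 * n) = 1) (hX : X * X = A ^ n)
    (hc : A * X = X * A⁻¹) : QuaternionGroup n →* G where
  toFun
    | a i => A ^ i.val
    | xa i => X * A ^ i.val
  map_one' := by
    rw [one_def]
    change A ^ (0 : ZMod (2 * n)).val = 1
    rw [ZMod.val_zero, pow_zero]
  map_mul' := by
    have hs : ∀ k : ℕ, A ^ k * X = X * (A ^ k)⁻¹ := fun k => by
      have h : SemiconjBy X A⁻¹ A := hc.symm
      rw [← inv_pow]
      exact (h.pow_right k).symm
    have hm : ∀ i j : ZMod (2 * n), A ^ i.val * (X * A ^ j.val) = X * A ^ (j - i).val := by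
      intro i j
      rw [pow_zmod_val_sub hA, ← mul_assoc, hs, mul_assoc]
    rintro (i | i) (j | j)
    · rw [a_mul_a]; exact pow_zmod_val_add hA i j
    · rw [a_mul_xa]; exact (hm i j).symm
    · rw [xa_mul_a]
      change X * A ^ (i + j).val = X * A ^ i.val * A ^ j.val
      rw [pow_zmod_val_add hA, mul_assoc]
    · rw [xa_mul_xa]
      change A ^ (_ : ZMod (2 * n)).val = X * A ^ i.val * (X * A ^ j.val)
      rw [mul_assoc, hm, ← mul_assoc, hX, add_sub_assoc, pow_zmod_val_add hA,
        pow_zmod_val_natCast hA]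

variable {A X : G} {hA : A ^ (2 * n) = 1} {hX : X * X = A ^ n} {hc : A * X = X * A⁻¹}

theorem quaternionLift_a (i : ZMod (2 * n)) : quaternionLift A X hA hX hc (a i) = A ^ i.val := rfl

theorem quaternionLift_xa (i : ZMod (2 * n)) :
    quaternionLift A X hA hX hc (xa i) = X * A ^ i.val := rfl

theorem quaternionLift_injective (ho : orderOf A = 2 * n) (h1 : ∀ k : ℕ, X * A ^ k ≠ 1) :
    Function.Injective (quaternionLift A X hA hX hc) := by
  rw [injective_iff_map_eq_one]
  rintro (i | i) h
  · rw [quaternionLift_a] at h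
    have h2 := orderOf_dvd_of_pow_eq_one h
    rw [ho] at h2
    have h3 := Nat.eq_zero_of_dvd_of_lt h2 (ZMod.val_lt i)
    rw [(ZMod.val_eq_zero i).1 h3, one_def]
  · exact absurd h (h1 _)

theorem quaternionGroup_hom_ext {f g : QuaternionGroup n →* G} (ha : f (a 1) = g (a 1))
    (hx : f (xa 0) = g (xa 0)) : f = g := by
  have h : ∀ i : ZMod (2 * n), f (a i) = g (a i) := fun i => by
    rw [← ZMod.natCast_zmod_val i, ← a_one_pow, map_pow, map_pow, ha]
  ext x
  cases x with
  | a i => exact h i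
  | xa i => rw [← zero_add i, ← xa_mul_a, map_mul, map_mul, h, hx]

end Quaternion

/-! ### Diagonal and antidiagonal matrices -/

/-- The diagonal matrix `diag(c, c⁻¹)`. -/
noncomputable def diagSU2 : Circle →* SU2 where
  toFun c := SU2.mk c 0 (by simp)
  map_one' := by
    apply Subtype.ext
    ext i j
    fin_cases i <;> fin_cases j <;> simp [SU2.mk]
  map_mul' c d := by
    obtain ⟨h, e⟩ := SU2.mk_mul c 0 d 0 (by simp) (by simp)
    rw [e]
    exact SU2.mk_congr (by simp) (by simp)

/-- The antidiagonal matrix with upper right entry `b`. -/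
noncomputable def antiSU2 (b : Circle) : SU2 := SU2.mk 0 b (by simp)

theorem diagSU2_apply (c : Circle) : diagSU2 c = SU2.mk c 0 (by simp) := rfl

theorem diagSU2_injective : Function.Injective diagSU2 := fun c d h => by
  apply Circle.ext
  exact congrArg (fun s : SU2 => (s : Matrix (Fin 2) (Fin 2) ℂ) 0 0) h

theorem antiSU2_ne_diagSU2 (b c : Circle) : antiSU2 b ≠ diagSU2 c := fun h => by
  have := congrArg (fun s : SU2 => (s : Matrix (Fin 2) (Fin 2) ℂ) 0 0) h
  exact c.coe_ne_zero this.symm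

theorem antiSU2_mul_diagSU2 (b c : Circle) : antiSU2 b * diagSU2 c = antiSU2 (b * c⁻¹) := by
  obtain ⟨h, e⟩ := SU2.mk_mul 0 b c 0 (by simp) (by simp)
  rw [antiSU2, diagSU2_apply, e]
  exact SU2.mk_congr (by simp) (by simp [Circle.coe_inv_eq_conj, -Circle.coe_inv])

theorem diagSU2_mul_antiSU2 (c b : Circle) : diagSU2 c * antiSU2 b = antiSU2 (c * b) := by
  obtain ⟨h, e⟩ := SU2.mk_mul c 0 0 b (by simp) (by simp)
  rw [antiSU2, diagSU2_apply, e]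
  exact SU2.mk_congr (by simp) (by simp)

theorem antiSU2_mul_antiSU2 (b d : Circle) : antiSU2 b * antiSU2 d = diagSU2 (-(b * d⁻¹)) := by
  obtain ⟨h, e⟩ := SU2.mk_mul 0 b 0 d (by simp) (by simp)
  rw [antiSU2, antiSU2, diagSU2_apply, e]
  exact SU2.mk_congr (by simp [Circle.coe_inv_eq_conj, -Circle.coe_inv]) (by simp)

theorem antiSU2_inv (b : Circle) : (antiSU2 b)⁻¹ = antiSU2 (-b) := by
  rw [inv_eq_iff_mul_eq_one, antiSU2_mul_antiSU2, ← map_one diagSU2]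
  congr 1
  apply Circle.ext
  simp

theorem antiSU2_mul_self (b : Circle) : antiSU2 b * antiSU2 b = diagSU2 (-1) := by
  rw [antiSU2_mul_antiSU2, mul_inv_cancel]

theorem diagSU2_comm_antiSU2 (c b : Circle) :
    diagSU2 c * antiSU2 b = antiSU2 b * (diagSU2 c)⁻¹ := by
  rw [← map_inv, diagSU2_mul_antiSU2, antiSU2_mul_diagSU2, inv_inv, mul_comm]

theorem pow_half_eq_neg_one {δ : Circle} {n : ℕ} (hn : n ≠ 0) (h : IsPrimitiveRoot δ (2 * n)) :
    δ ^ n = -1 := by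
  have h1 : ((δ ^ n : Circle) : ℂ) * (δ ^ n : Circle) = 1 := by
    rw [← Circle.coe_mul, ← pow_add, ← two_mul, h.pow_eq_one, Circle.coe_one]
  apply Circle.ext
  rw [Circle.coe_neg, Circle.coe_one]
  refine (mul_self_eq_one_iff.1 h1).resolve_left fun h2 => ?_
  have := Nat.le_of_dvd (Nat.pos_of_ne_zero hn)
    (h.dvd_of_pow_eq_one n (Circle.ext (by rw [h2, Circle.coe_one])))
  omega

/-- The embedding of the quaternion group of order `4n` into the monomial matrices of `SU₂(ℂ)` given
by a primitive `2n`-th root of unity and an antidiagonal matrix. -/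
noncomputable def monomialHom {n : ℕ} [NeZero n] (δ b : Circle) (h : IsPrimitiveRoot δ (2 * n)) :
    QuaternionGroup n →* SU2 :=
  quaternionLift (diagSU2 δ) (antiSU2 b) (by rw [← map_pow, h.pow_eq_one, map_one])
    (by rw [← map_pow, pow_half_eq_neg_one (NeZero.ne n) h, antiSU2_mul_self])
    (diagSU2_comm_antiSU2 δ b)

section MonomialHom

open QuaternionGroup

variable {n : ℕ} [NeZero n] {δ b : Circle} (h : IsPrimitiveRoot δ (2 * n))

theorem monomialHom_a (i : ZMod (2 * n)) : monomialHom δ b h (a i) = diagSU2 (δ ^ i.val) := by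
  rw [monomialHom, quaternionLift_a, map_pow]

theorem monomialHom_xa (i : ZMod (2 * n)) :
    monomialHom δ b h (xa i) = antiSU2 (b * (δ ^ i.val)⁻¹) := by
  rw [monomialHom, quaternionLift_xa, ← map_pow, antiSU2_mul_diagSU2]

theorem monomialHom_injective : Function.Injective (monomialHom δ b h) := by
  refine quaternionLift_injective ?_ fun k => ?_
  · rw [orderOf_injective diagSU2 diagSU2_injective, ← h.eq_orderOf]
  · rw [← map_pow, antiSU2_mul_diagSU2, ← map_one diagSU2]
    exact antiSU2_ne_diagSU2 _ _

end MonomialHom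

theorem isPrimitiveRoot_circle_coe {c : Circle} {m : ℕ} :
    IsPrimitiveRoot (c : ℂ) m ↔ IsPrimitiveRoot c m :=
  IsPrimitiveRoot.map_iff_of_injective (f := Circle.coeHom) Circle.coe_injective

theorem circle_eq_pow_of_pow_eq_one {γ c : Circle} {m : ℕ} (hm : m ≠ 0) (h : IsPrimitiveRoot γ m)
    (hc : c ^ m = 1) : ∃ k : ℕ, c = γ ^ k := by
  have : NeZero m := ⟨hm⟩
  obtain ⟨k, -, hk⟩ := (isPrimitiveRoot_circle_coe.2 h).eq_pow_of_pow_eq_one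
    (ξ := (c : ℂ)) (by rw [← Circle.coe_pow, hc, Circle.coe_one])
  exact ⟨k, Circle.ext (by rw [Circle.coe_pow, hk])⟩

/-- If the `i`-th power of some primitive `m`-th root of unity is a primitive `d`-th root of unity,
then every primitive `d`-th root of unity is the `i`-th power of a primitive `m`-th root of unity,
because units modulo `d` lift to units modulo `m`. -/
theorem exists_isPrimitiveRoot_pow_eq {ζ γ : Circle} {m d i : ℕ} (hm : m ≠ 0) (hdm : d ∣ m)
    (hζ : IsPrimitiveRoot ζ m) (hζi : IsPrimitiveRoot (ζ ^ i) d) (hγ : IsPrimitiveRoot γ d) :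
    ∃ δ : Circle, IsPrimitiveRoot δ m ∧ δ ^ i = γ := by
  have : NeZero m := ⟨hm⟩
  have : NeZero d := ⟨ne_zero_of_dvd_ne_zero hm hdm⟩
  obtain ⟨w, -, hw, e⟩ := (isPrimitiveRoot_circle_coe.2 hζi).isPrimitiveRoot_iff.1
    (isPrimitiveRoot_circle_coe.2 hγ)
  obtain ⟨u, hu⟩ := ZMod.unitsMap_surjective hdm (ZMod.unitOfCoprime w hw)
  have hu' := congrArg Units.val hu
  rw [ZMod.unitsMap_def, Units.coe_map, ZMod.coe_unitOfCoprime] at hu'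
  have hmod : (u : ZMod m).val ≡ w [MOD d] := by
    rw [← ZMod.natCast_eq_natCast_iff, ← hu']
    simp
  refine ⟨ζ ^ (u : ZMod m).val, hζ.pow_of_coprime _ (ZMod.val_coe_unit_coprime u), ?_⟩
  rw [← pow_mul, mul_comm, pow_mul]
  have : (ζ ^ i) ^ (u : ZMod m).val = (ζ ^ i) ^ w := by
    rw [pow_eq_pow_iff_modEq, ← hζi.eq_orderOf]; exact hmod
  rw [this]
  apply Circle.ext
  rw [Circle.coe_pow, e]

/-! ### Diagonalizing elements of order eight in the binary octahedral group -/

/-- The rotation `g` sends the `i`-th coordinate axis to the `j`-th one. -/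
def MapsAxis (g : SO3) (i j : Fin 3) : Prop :=
  (g : Matrix (Fin 3) (Fin 3) ℝ) *ᵥ Pi.single i 1 = Pi.single j 1 ∨
    (g : Matrix (Fin 3) (Fin 3) ℝ) *ᵥ Pi.single i 1 = -Pi.single j 1

theorem MapsAxis.comp {g h : SO3} {i j k : Fin 3} (hg : MapsAxis g j k) (hh : MapsAxis h i j) :
    MapsAxis (g * h) i k := by
  have e : ((g * h : SO3) : Matrix (Fin 3) (Fin 3) ℝ) *ᵥ Pi.single i 1
      = (g : Matrix (Fin 3) (Fin 3) ℝ) *ᵥ ((h : Matrix (Fin 3) (Fin 3) ℝ) *ᵥ Pi.single i 1) := by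
    rw [mulVec_mulVec]; rfl
  rw [MapsAxis, e]
  rcases hg with hg | hg <;> rcases hh with hh | hh <;> rw [hh] <;>
    simp only [mulVec_neg, hg, neg_neg, true_or, or_true]

theorem MapsAxis.inv {g : SO3} {i j : Fin 3} (hg : MapsAxis g i j) : MapsAxis g⁻¹ j i := by
  have e : ((g⁻¹ : SO3) : Matrix (Fin 3) (Fin 3) ℝ) *ᵥ ((g : Matrix (Fin 3) (Fin 3) ℝ) *ᵥ
      Pi.single i 1) = Pi.single i 1 := by
    have h : ((g⁻¹ : SO3) : Matrix (Fin 3) (Fin 3) ℝ) * (g : Matrix (Fin 3) (Fin 3) ℝ) = 1 :=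
      congrArg Subtype.val (inv_mul_cancel g)
    rw [mulVec_mulVec, h, one_mulVec]
  rw [MapsAxis]
  rcases hg with hg | hg <;> rw [hg] at e
  · exact Or.inl e
  · rw [mulVec_neg] at e
    exact Or.inr (by rw [← e, neg_neg])

theorem MapsAxis.entry_sq {g : SO3} {i j : Fin 3} (hg : MapsAxis g i j) (k : Fin 3) :
    (g : Matrix (Fin 3) (Fin 3) ℝ) k i ^ 2 = if k = j then 1 else 0 := by
  have e : (g : Matrix (Fin 3) (Fin 3) ℝ) k i
      = ((g : Matrix (Fin 3) (Fin 3) ℝ) *ᵥ Pi.single i 1) k := by simp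
  rw [e]
  rcases hg with hg | hg <;> rw [hg] <;> by_cases h : k = j <;> simp [h]

theorem MapsAxis.eq {g : SO3} {i j k : Fin 3} (hg : MapsAxis g i j) (hg' : MapsAxis g i k) :
    j = k := by
  have h1 := hg.entry_sq j
  rw [hg'.entry_sq j] at h1
  by_contra h
  simp [h] at h1

theorem exists_mapsAxis {g : SO3} (hg : g ∈ octahedralGroup) (i : Fin 3) : ∃ j, MapsAxis g i j :=
  (mem_octahedralGroup_iff g).1 hg i

theorem mapsAxis_one (i : Fin 3) : MapsAxis 1 i i := Or.inl (one_mulVec _)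

/-- A rotation of the octahedron whose eighth power is trivial preserves a coordinate axis, because
a `3`-cycle has order `3`. -/
theorem exists_mapsAxis_self {g : SO3} (hg : g ∈ octahedralGroup) (h8 : g ^ 8 = 1) :
    ∃ i, MapsAxis g i i := by
  choose σ hσ using exists_mapsAxis hg
  have hpow : ∀ (m : ℕ) (i : Fin 3), MapsAxis (g ^ m) i (σ^[m] i) := by
    intro m
    induction m with
    | zero => intro i; rw [pow_zero]; exact mapsAxis_one i
    | succ m ih =>
      intro i
      rw [pow_succ', Function.iterate_succ_apply']
      exact (hσ _).comp (ih i)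
  have h : ∀ i, σ^[8] i = i := fun i => (hpow 8 i).eq (h8 ▸ mapsAxis_one i)
  have key : ∀ τ : Fin 3 → Fin 3, (∀ i, τ^[8] i = i) → ∃ i, τ i = i := by decide
  obtain ⟨i, hi⟩ := key σ h
  exact ⟨i, by simpa [hi] using hσ i⟩

theorem exists_sqrt_half : ∃ r : ℂ, (starRingEnd ℂ) r = r ∧ r * r = 1 / 2 := by
  refine ⟨(Real.sqrt (1 / 2) : ℝ), Complex.conj_ofReal _, ?_⟩
  rw [← Complex.ofReal_mul, Real.mul_self_sqrt (by norm_num)]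
  norm_num

/-- The binary octahedral group moves every coordinate axis to the third one. -/
theorem exists_mem_E48_mapsAxis (i : Fin 3) : ∃ c ∈ E48, MapsAxis (Ad c) i 2 := by
  obtain ⟨r, hr, hr2⟩ := exists_sqrt_half
  have hnr : Complex.normSq r = 1 / 2 := by
    have : (Complex.normSq r : ℂ) = 1 / 2 := by rw [← Complex.mul_conj, hr, hr2]
    exact_mod_cast (by rw [this]; norm_num : (Complex.normSq r : ℂ) = ((1 / 2 : ℝ) : ℂ))
  obtain ⟨l, hl⟩ := exists_circle_eq (z := (1 + Complex.I) * r)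
    (by rw [map_mul, hnr]; norm_num [Complex.normSq_apply])
  -- the matrices with first row `(r, u r)`, where `u` is a fourth root of unity
  have hE : ∀ (u : ℂ) (hu : u ^ 4 = 1) (hn : Complex.normSq r + Complex.normSq (u * r) = 1),
      SU2.mk r (u * r) hn ∈ E48 := by
    intro u hu hn
    have h0 : (1 + Complex.I) * (1 / 2) ∈ ringR 4 :=
      mul_mem (add_mem (one_mem _) I_mem_ringR) (half_mem_ringR 4)
    have h1 : (l : ℂ) * r = (1 + Complex.I) * (1 / 2) := by rw [hl, mul_assoc, hr2]
    have hu' : ((starRingEnd ℂ) u) ^ 4 = 1 := by rw [← map_pow, hu, map_one]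
    refine mem_E48_of_clifford (c := l) (scalar_mul_mk_mem (by norm_num) ?_ ?_ ?_ ?_)
    · rw [h1]; exact h0
    · rw [mul_left_comm, h1]; exact mul_mem (mem_ringR_of_pow_four hu) h0
    · rw [map_mul, hr, mul_left_comm, h1]; exact mul_mem (mem_ringR_of_pow_four hu') h0
    · rw [hr, h1]; exact h0
  have haxis : ∀ {s : SU2} {k : Fin 3}, s ∈ E48 →
      ((Ad s : SO3) : Matrix (Fin 3) (Fin 3) ℝ) 2 k ≠ 0 → MapsAxis (Ad s) k 2 := by
    intro s k hs h
    obtain ⟨j, hj⟩ := exists_mapsAxis (g := Ad s) hs k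
    have h2 := hj.entry_sq 2
    by_cases h3 : 2 = j
    · rwa [← h3] at hj
    · rw [if_neg h3] at h2
      exact absurd (pow_eq_zero_iff two_ne_zero |>.1 h2) h
  fin_cases i
  · have hn : Complex.normSq r + Complex.normSq (1 * r) = 1 := by
      rw [map_mul, hnr]; norm_num
    refine ⟨_, hE 1 (by norm_num) hn, haxis (hE 1 (by norm_num) hn) ?_⟩
    change ((Ad (SU2.mk r (1 * r) hn) : SO3) : Matrix (Fin 3) (Fin 3) ℝ) 2 0 ≠ 0
    rw [conjMatrix_mk_two_zero, one_mul, hr, hr2]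
    norm_num
  · have hn : Complex.normSq r + Complex.normSq (Complex.I * r) = 1 := by
      rw [map_mul, hnr]; norm_num [Complex.normSq_apply]
    refine ⟨_, hE _ Complex.I_pow_four hn, haxis (hE _ Complex.I_pow_four hn) ?_⟩
    change ((Ad (SU2.mk r (Complex.I * r) hn) : SO3) : Matrix (Fin 3) (Fin 3) ℝ) 2 1 ≠ 0
    rw [conjMatrix_mk_two_one, map_mul, hr, mul_left_comm r, hr2]
    simp
  · exact ⟨1, one_mem _, by rw [map_one]; exact mapsAxis_one 2⟩

theorem circle_of_mk_zero_right {a : ℂ} {h} :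
    ∃ c : Circle, (c : ℂ) = a ∧ SU2.mk a 0 h = diagSU2 c := by
  obtain ⟨c, rfl⟩ := exists_circle_eq (z := a) (by simpa using h)
  exact ⟨c, rfl, rfl⟩

theorem circle_of_mk_zero_left {b : ℂ} {h} :
    ∃ c : Circle, (c : ℂ) = b ∧ SU2.mk 0 b h = antiSU2 c := by
  obtain ⟨c, rfl⟩ := exists_circle_eq (z := b) (by simpa using h)
  exact ⟨c, rfl, rfl⟩

/-- Elements of order eight in the binary octahedral group are conjugate to diagonal ones. -/
theorem exists_conj_eq_diagSU2 {s : SU2} (hs : s ∈ E48) (ho : orderOf s = 8) :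
    ∃ c ∈ E48, ∃ γ : Circle, c * s * c⁻¹ = diagSU2 γ := by
  have h8 : s ^ 8 = 1 := by rw [← ho, pow_orderOf_eq_one]
  obtain ⟨i, hi⟩ := exists_mapsAxis_self (g := Ad s) hs (by rw [← map_pow, h8, map_one])
  obtain ⟨c, hc, hci⟩ := exists_mem_E48_mapsAxis i
  refine ⟨c, hc, ?_⟩
  have h2 : MapsAxis (Ad (c * s * c⁻¹)) 2 2 := by
    rw [map_mul, map_mul, map_inv]
    exact (hci.comp hi).comp hci.inv
  have h3 := h2.entry_sq 2
  have hpow : (c * s * c⁻¹) ^ 4 ≠ 1 := by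
    rw [conj_pow, Ne, conj_eq_one_iff]
    intro h
    have := orderOf_dvd_of_pow_eq_one h
    rw [ho] at this
    norm_num at this
  obtain ⟨a, b, h, e⟩ := (c * s * c⁻¹).exists_eq_mk
  rw [e] at h3 hpow ⊢
  rw [conjMatrix_mk_two_two, if_pos rfl] at h3
  have h4 : Complex.normSq a * Complex.normSq b = 0 := by nlinarith
  rcases mul_eq_zero.1 h4 with h5 | h5
  · obtain rfl := Complex.normSq_eq_zero.1 h5
    obtain ⟨d, -, hd⟩ := circle_of_mk_zero_left (h := h)
    refine absurd ?_ hpow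
    rw [hd, show 4 = 2 * 2 from rfl, pow_mul, pow_two (antiSU2 d), antiSU2_mul_self, ← map_pow,
      ← map_one diagSU2]
    congr 1
    apply Circle.ext
    simp
  · obtain rfl := Complex.normSq_eq_zero.1 h5
    obtain ⟨d, -, hd⟩ := circle_of_mk_zero_right (h := h)
    exact ⟨d, hd⟩

/-! ### The action on the ping-pong regions -/

section Action

variable {Γ : Type*} [LinearOrderedCommGroupWithZero Γ] (v : Valuation ℂ Γ)

/-- The matrices in `SU₂(ℂ)` whose first column lies in the near region. -/
def nearSet : Set SU2 :=
  {s | NearRegion v ((s : Matrix (Fin 2) (Fin 2) ℂ) 0 0) ((s : Matrix (Fin 2) (Fin 2) ℂ) 1 0)}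

/-- The matrices in `SU₂(ℂ)` whose first column lies in the far region. -/
def farSet : Set SU2 :=
  {s | FarRegion v ((s : Matrix (Fin 2) (Fin 2) ℂ) 0 0) ((s : Matrix (Fin 2) (Fin 2) ℂ) 1 0)}

theorem mk_mul_apply_zero_zero (a b : ℂ) (h) (t : SU2) :
    ((SU2.mk a b h * t : SU2) : Matrix (Fin 2) (Fin 2) ℂ) 0 0
      = a * (t : Matrix (Fin 2) (Fin 2) ℂ) 0 0 + b * (t : Matrix (Fin 2) (Fin 2) ℂ) 1 0 := by
  change ((SU2.mk a b h : Matrix (Fin 2) (Fin 2) ℂ) * t) 0 0 = _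
  simp [SU2.mk, Matrix.mul_apply, Fin.sum_univ_two]

theorem mk_mul_apply_one_zero (a b : ℂ) (h) (t : SU2) :
    ((SU2.mk a b h * t : SU2) : Matrix (Fin 2) (Fin 2) ℂ) 1 0
      = -(starRingEnd ℂ) b * (t : Matrix (Fin 2) (Fin 2) ℂ) 0 0
        + (starRingEnd ℂ) a * (t : Matrix (Fin 2) (Fin 2) ℂ) 1 0 := by
  change ((SU2.mk a b h : Matrix (Fin 2) (Fin 2) ℂ) * t) 1 0 = _
  simp [SU2.mk, Matrix.mul_apply, Fin.sum_univ_two]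

theorem mul_conj_of_pow_four {u : ℂ} (hu : u ^ 4 = 1) : u * (starRingEnd ℂ) u = 1 := by
  rcases eq_of_pow_four_eq_one hu with rfl | rfl | rfl | rfl <;> simp

variable {v} {a u w : ℂ} {h : Complex.normSq a + Complex.normSq (u * a) = 1}

theorem dense_mul_mem_nearSet_of_far (h2 : v 2 < 1) (ha : a ≠ 0) (hu : u ^ 4 = 1) (hw : w ^ 4 = 1)
    (haw : (starRingEnd ℂ) a = w * a) {t : SU2} (ht : t ∈ farSet v) :
    SU2.mk a (u * a) h * t ∈ nearSet v := by
  have hu' : ((starRingEnd ℂ) u) ^ 4 = 1 := by rw [← map_pow, hu, map_one]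
  have h1 := ((FarRegion.hadamard h2 (ht.mul_pow_four h2 hu)).mul_pow_four h2
    (u := w * (starRingEnd ℂ) u) (by rw [mul_pow, hw, hu', one_mul])).smul ha
  change NearRegion v _ _
  rw [mk_mul_apply_zero_zero, mk_mul_apply_one_zero, map_mul, haw]
  convert h1 using 1
  · ring
  · linear_combination (-w * a * (t : Matrix (Fin 2) (Fin 2) ℂ) 1 0) * mul_conj_of_pow_four hu

theorem dense_mul_diagSU2_mem_nearSet (h2 : v 2 < 1) (ha : a ≠ 0) (hu : u ^ 4 = 1) (hw : w ^ 4 = 1)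
    (haw : (starRingEnd ℂ) a = w * a) (c : Circle) :
    SU2.mk a (u * a) h * diagSU2 c ∈ nearSet v := by
  have hu' : ((starRingEnd ℂ) u) ^ 4 = 1 := by rw [← map_pow, hu, map_one]
  have h1 := nearRegion_of_pow_four (v := v) h2 (mul_ne_zero ha c.coe_ne_zero)
    (u := -((starRingEnd ℂ) u * w)) (by rw [neg_pow, mul_pow, hw, hu']; norm_num)
  change NearRegion v _ _
  rw [mk_mul_apply_zero_zero, mk_mul_apply_one_zero, map_mul, haw]
  convert h1 using 1 <;> simp [diagSU2_apply, SU2.mk]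
  ring

theorem dense_mul_antiSU2_mem_nearSet (h2 : v 2 < 1) (ha : a ≠ 0) (hu : u ^ 4 = 1) (hw : w ^ 4 = 1)
    (haw : (starRingEnd ℂ) a = w * a) (c : Circle) :
    SU2.mk a (u * a) h * antiSU2 c ∈ nearSet v := by
  have hu' : ((starRingEnd ℂ) u) ^ 4 = 1 := by rw [← map_pow, hu, map_one]
  have hu0 : u ≠ 0 := by rintro rfl; norm_num at hu
  have hc0 : (starRingEnd ℂ) (c : ℂ) ≠ 0 := by simp
  have h1 := nearRegion_of_pow_four (v := v) h2
    (mul_ne_zero (mul_ne_zero hu0 ha) (neg_ne_zero.2 hc0))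
    (u := w * (starRingEnd ℂ) u) (by rw [mul_pow, hw, hu']; norm_num)
  change NearRegion v _ _
  rw [mk_mul_apply_zero_zero, mk_mul_apply_one_zero, map_mul, haw]
  convert h1 using 1 <;> simp [antiSU2, SU2.mk, -Circle.coe_inv]
  linear_combination (-w * a * (starRingEnd ℂ) (c : ℂ)) * mul_conj_of_pow_four hu

theorem conj_circle (c : Circle) : (starRingEnd ℂ) (c : ℂ) = ((c⁻¹ : Circle) : ℂ) :=
  (Circle.coe_inv_eq_conj c).symm

theorem diagSU2_mul_mem_farSet (h2 : v 2 < 1) {d : Circle} {m : ℕ} (hm : m ≠ 0) (hd : d ^ m = 1)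
    (h8 : d ^ 8 ≠ 1) {t : SU2} (ht : t ∈ nearSet v) : diagSU2 d * t ∈ farSet v := by
  have h1 := (NearRegion.mul_root h2 ht (ω := ((d⁻¹ ^ 2 : Circle) : ℂ)) hm
    (by rw [← Circle.coe_pow, ← pow_mul, mul_comm, pow_mul, inv_pow, hd, inv_one, one_pow,
      Circle.coe_one])
    (by
      rw [← Circle.coe_pow, ← pow_mul, inv_pow, Ne, Circle.coe_eq_one, inv_eq_one]
      exact h8)).smul d.coe_ne_zero
  change FarRegion v _ _
  rw [diagSU2_apply, mk_mul_apply_zero_zero, mk_mul_apply_one_zero, conj_circle]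
  convert h1 using 1
  · simp
  · rw [map_zero, neg_zero, zero_mul, zero_add, ← mul_assoc, ← Circle.coe_mul]
    congr 2
    rw [sq, mul_inv_cancel_left]

theorem antiSU2_mul_mem_nearSet (h2 : v 2 < 1) {d : Circle} (h8 : d ^ 8 = 1) {t : SU2}
    (ht : t ∈ nearSet v) :
    antiSU2 d * t ∈ nearSet v := by
  have h1 := ((NearRegion.swap h2 ht).mul_pow_four h2 (u := ((-(d⁻¹ ^ 2) : Circle) : ℂ)) (by
    rw [Circle.coe_neg, neg_pow, ← Circle.coe_pow, ← pow_mul, inv_pow, h8]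
    norm_num)).smul d.coe_ne_zero
  change NearRegion v _ _
  rw [antiSU2, mk_mul_apply_zero_zero, mk_mul_apply_one_zero, conj_circle]
  convert h1 using 1
  · simp
  · rw [map_zero, zero_mul, add_zero, ← mul_assoc, ← Circle.coe_mul, ← Circle.coe_neg]
    congr 2
    apply Circle.ext
    simp [sq]

theorem diagSU2_notMem_nearSet (h2 : v 2 < 1) (c : Circle) : diagSU2 c ∉ nearSet v := fun h => by
  have := h.ne_zero h2
  simp [diagSU2_apply, SU2.mk] at this

theorem antiSU2_notMem_nearSet (c : Circle) : antiSU2 c ∉ nearSet v := fun h => by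
  have := h.1
  simp [antiSU2, SU2.mk] at this

theorem diagSU2_notMem_farSet (c : Circle) : diagSU2 c ∉ farSet v := fun h => by
  have := h.ne_zero
  simp [diagSU2_apply, SU2.mk] at this

theorem antiSU2_notMem_farSet (c : Circle) : antiSU2 c ∉ farSet v := fun h => by
  have := h.1
  simp [antiSU2, SU2.mk] at this

end Action

/-! ### The amalgamated product -/

section Amalgamated

open QuaternionGroup

theorem diagSU2_mem_E48_pow {c : Circle} (h : diagSU2 c ∈ E48) : c ^ 8 = 1 := by
  apply Circle.ext
  rcases E48_cases (h := by simp) h with ⟨-, h⟩ | ⟨h, -⟩ | ⟨h0, -, u, w, hu, -, h, -⟩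
  · rw [Circle.coe_pow, h, Circle.coe_one]
  · exact absurd h c.coe_ne_zero
  · rcases mul_eq_zero.1 h.symm with h | h
    · rw [h] at hu; norm_num at hu
    · exact absurd h h0

theorem antiSU2_mem_E48_pow {c : Circle} (h : antiSU2 c ∈ E48) : c ^ 8 = 1 := by
  apply Circle.ext
  rcases E48_cases (h := by simp) h with ⟨h, -⟩ | ⟨-, h⟩ | ⟨h0, -⟩
  · exact absurd h c.coe_ne_zero
  · rw [Circle.coe_pow, h, Circle.coe_one]
  · exact absurd rfl h0

/-- An element inverting a non-scalar diagonal matrix by conjugation is antidiagonal. -/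
theorem exists_eq_antiSU2 {s : SU2} {γ : Circle} (hγ : γ ^ 2 ≠ 1)
    (hs : s * diagSU2 γ * s⁻¹ = (diagSU2 γ)⁻¹) : ∃ c, s = antiSU2 c := by
  obtain ⟨a, b, h, rfl⟩ := s.exists_eq_mk
  rw [mul_inv_eq_iff_eq_mul, ← map_inv] at hs
  have h1 := congrArg (fun s : SU2 => (s : Matrix (Fin 2) (Fin 2) ℂ) 0 0) hs
  simp only [diagSU2_apply, mk_mul_apply_zero_zero] at h1
  have h2 : a * (γ : ℂ) = ((γ⁻¹ : Circle) : ℂ) * a := by simpa [SU2.mk] using h1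
  have h3 : a = 0 := by
    by_contra h0
    rw [mul_comm] at h2
    have h4 : γ = γ⁻¹ := Circle.ext (mul_right_cancel₀ h0 h2)
    apply hγ
    rw [sq]
    nth_rw 1 [h4]
    exact inv_mul_cancel γ
  subst h3
  obtain ⟨c, -, hc⟩ := circle_of_mk_zero_left (h := h)
  exact ⟨c, hc⟩

theorem isPrimitiveRoot_of_orderOf_diagSU2 {γ : Circle} {m : ℕ} (h : orderOf (diagSU2 γ) = m) :
    IsPrimitiveRoot γ m := by
  rw [orderOf_injective diagSU2 diagSU2_injective] at h
  exact h ▸ IsPrimitiveRoot.orderOf γ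

/-- After a conjugation in the binary octahedral group, an embedding of `Q₁₆` sends the standard
generators to a diagonal and an antidiagonal matrix. -/
theorem exists_conj_standard {f : QuaternionGroup 4 →* E48} (hf : Function.Injective f) :
    ∃ c ∈ E48, ∃ γ y : Circle, IsPrimitiveRoot γ 8 ∧ c * f (a 1) * c⁻¹ = diagSU2 γ ∧
      c * f (xa 0) * c⁻¹ = antiSU2 y := by
  have ho : orderOf (f (a 1) : SU2) = 8 := by
    rw [← Subgroup.coe_subtype, orderOf_injective _ E48.subtype_injective, orderOf_injective f hf,
      orderOf_a_one]
  obtain ⟨c, hc, γ, hγ⟩ := exists_conj_eq_diagSU2 (f (a 1)).2 ho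
  have hγ8 : IsPrimitiveRoot γ 8 := by
    apply isPrimitiveRoot_of_orderOf_diagSU2
    rw [← hγ, ← ho]
    exact orderOf_injective (MulAut.conj c).toMonoidHom (MulAut.conj c).injective _
  have hrel : (f (xa 0) : SU2) * f (a 1) * (f (xa 0) : SU2)⁻¹ = (f (a 1) : SU2)⁻¹ := by
    have := congrArg f (quaternionGroup_xa_conj_a (n := 4) 0 1)
    rw [map_mul, map_mul, map_inv, map_inv] at this
    exact congrArg Subtype.val this
  obtain ⟨y, hy⟩ := exists_eq_antiSU2 (s := c * f (xa 0) * c⁻¹) (γ := γ)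
    (fun h => by have := hγ8.dvd_of_pow_eq_one 2 h; norm_num at this) (by
      rw [← hγ]
      calc _ = c * ((f (xa 0) : SU2) * f (a 1) * (f (xa 0) : SU2)⁻¹) * c⁻¹ := by group
        _ = _ := by rw [hrel]; group)
  exact ⟨c, hc, γ, y, hγ8, hγ, hy⟩

/-- An embedding of `Q₁₆` in a quaternion group sends `a` into the cyclic part and `x` outside. -/
theorem exists_eq_of_quaternion_injective {n : ℕ} [NeZero n]
    {g : QuaternionGroup 4 →* QuaternionGroup n} (hg : Function.Injective g) :
    (∃ i, g (a 1) = a i ∧ orderOf (a i : QuaternionGroup n) = 8) ∧ ∃ j, g (xa 0) = xa j := by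
  have ho : orderOf (g (a 1)) = 8 := by rw [orderOf_injective g hg, orderOf_a_one]
  obtain ⟨i, hi⟩ : ∃ i, g (a 1) = a i := by
    cases e : g (a 1) with
    | a i => exact ⟨i, rfl⟩
    | xa i => rw [e, orderOf_xa] at ho; norm_num at ho
  refine ⟨⟨i, hi, hi ▸ ho⟩, ?_⟩
  cases e : g (xa 0) with
  | xa j => exact ⟨j, rfl⟩
  | a j =>
    exfalso
    have h1 := congrArg g (quaternionGroup_xa_conj_a (n := 4) 0 1)
    rw [map_mul, map_mul, map_inv, map_inv, e, hi, a_mul_a, add_comm, ← a_mul_a,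
      mul_inv_cancel_right, ← hi, eq_inv_iff_mul_eq_one, ← sq] at h1
    have h3 := orderOf_dvd_of_pow_eq_one h1
    rw [ho] at h3
    norm_num at h3

/-- The family consisting of two homomorphisms with a common target. -/
def amalgamDesc {A B K : Type} [Group A] [Group B] [Group K] (φ : A →* K) (ψ : B →* K) :
    ∀ b, AmalgamFactor A B b →* K
  | false => φ
  | true => ψ

/-- The homomorphism from the amalgamated product is a conjugation on `E_48` and, on `Q_{4n}`, the
embedding in the monomial matrices that agrees with it on `Q₁₆`. -/
theorem nonempty_groupH_mulEquiv_amalgam {n : ℕ} (hn : n ≠ 0) (h4 : 4 ∣ n)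
    {f : QuaternionGroup 4 →* E48} {g : QuaternionGroup 4 →* QuaternionGroup n}
    (hf : Function.Injective f) (hg : Function.Injective g) :
    Nonempty (groupH n ≃* Amalgam f g) := by
  have : NeZero n := ⟨hn⟩
  obtain ⟨c, hc, γ, y, hγ, hfa, hfx⟩ := exists_conj_standard hf
  obtain ⟨⟨i, hi, hoi⟩, j, hj⟩ := exists_eq_of_quaternion_injective hg
  -- the embedding of `E_48` conjugated by `c`
  let φ : E48 →* SU2 := (MulAut.conj c).toMonoidHom.comp E48.subtype
  have hφ : ∀ s : E48, φ s = c * s * c⁻¹ := fun s => rfl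
  have hφinj : Function.Injective φ :=
    (MulAut.conj c).injective.comp E48.subtype_injective
  have hφE : ∀ s : E48, φ s ∈ E48 := fun s => mul_mem (mul_mem hc s.2) (inv_mem hc)
  -- a primitive `2n`-th root of unity `δ` with `δ ^ i = γ`
  obtain ⟨ζ, hζ'⟩ := exists_circle_eq (zeta_normSq (2 * n))
  have hζ : IsPrimitiveRoot ζ (2 * n) := by
    rw [← isPrimitiveRoot_circle_coe, hζ']
    exact isPrimitiveRoot_zeta (mul_ne_zero two_ne_zero hn)
  have hζi : IsPrimitiveRoot (ζ ^ i.val) 8 := by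
    rw [orderOf_a] at hoi
    have hd : orderOf (ζ ^ i.val) = 8 := by
      have hfin : IsOfFinOrder ζ := isOfFinOrder_iff_pow_eq_one.2 ⟨2 * n, by omega, hζ.pow_eq_one⟩
      rw [hfin.orderOf_pow, ← hζ.eq_orderOf, hoi]
    exact hd ▸ IsPrimitiveRoot.orderOf _
  obtain ⟨δ, hδ, hδi⟩ := exists_isPrimitiveRoot_pow_eq (mul_ne_zero two_ne_zero hn)
    (mul_dvd_mul_left 2 h4) hζ hζi hγ
  let ψ : QuaternionGroup n →* SU2 := monomialHom δ (y * δ ^ j.val) hδ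
  have hψinj : Function.Injective ψ := monomialHom_injective hδ
  have hψa : ∀ k, ψ (a k) = diagSU2 (δ ^ k.val) := fun k => monomialHom_a hδ k
  have hψxa : ∀ k, ∃ b, ψ (xa k) = antiSU2 b := fun k => ⟨_, monomialHom_xa hδ k⟩
  have hψxj : ψ (xa j) = antiSU2 y := by
    have := monomialHom_xa (b := y * δ ^ j.val) hδ j
    rwa [mul_inv_cancel_right] at this
  have hcomp : φ.comp f = ψ.comp g := by
    apply quaternionGroup_hom_ext
    · change φ (f (a 1)) = ψ (g (a 1))
      rw [hφ, hfa, hi, hψa, hδi]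
    · change φ (f (xa 0)) = ψ (g (xa 0))
      rw [hφ, hfx, hj, hψxj]
  have hcomp' : ∀ q, φ (f q) = ψ (g q) := DFunLike.congr_fun hcomp
  have hy8 : y ^ 8 = 1 := antiSU2_mem_E48_pow (hfx ▸ hφE (f (xa 0)))
  -- the diagonal matrices with eighth roots of unity belong to the amalgamated subgroup
  have hdiag : ∀ d : Circle, d ^ 8 = 1 → ∃ q, φ (f q) = diagSU2 d := by
    intro d hd
    obtain ⟨k, rfl⟩ := circle_eq_pow_of_pow_eq_one (by norm_num) hγ hd
    exact ⟨a 1 ^ k, by rw [map_pow, map_pow, hφ, hfa, ← map_pow]⟩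
  have hφf : φ (f (xa 0)) = antiSU2 y := by rw [hφ, hfx]
  -- the elements of `E_48` outside of the amalgamated subgroup are not monomial
  have hdense : ∀ s ∉ f.range, ∃ (p u w : ℂ) (h : _), φ s = SU2.mk p (u * p) h ∧ p ≠ 0 ∧ u ^ 4 = 1 ∧
      w ^ 4 = 1 ∧ (starRingEnd ℂ) p = w * p := by
    intro s hs
    have hsE := hφE s
    obtain ⟨p, q, h, e⟩ := (φ s).exists_eq_mk
    rw [e] at hsE
    rcases E48_cases hsE with ⟨rfl, -⟩ | ⟨rfl, -⟩ | ⟨hp, -, u, w, hu, hw, rfl, hpw⟩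
    · exfalso
      obtain ⟨d, -, hd⟩ := circle_of_mk_zero_right (h := h)
      rw [hd] at hsE e
      obtain ⟨t, ht⟩ := hdiag d (diagSU2_mem_E48_pow hsE)
      exact hs ⟨t, hφinj (ht.trans e.symm)⟩
    · exfalso
      obtain ⟨d, -, hd⟩ := circle_of_mk_zero_left (h := h)
      rw [hd] at hsE e
      have h1 : φ (s * f (xa 0)) = diagSU2 (-(d * y⁻¹)) := by
        rw [map_mul, e, hφf, antiSU2_mul_antiSU2]
      obtain ⟨t, ht⟩ := hdiag _ (diagSU2_mem_E48_pow (h1 ▸ hφE _))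
      have h2 := hφinj (ht.trans h1.symm)
      exact hs ⟨t * (xa 0)⁻¹, by rw [map_mul, map_inv, h2, mul_inv_cancel_right]⟩
    · exact ⟨p, u, w, h, e, hp, hu, hw, hpw⟩
  -- the diagonal elements of `Q_{4n}` outside of the amalgamated subgroup
  have hroot : ∀ k, (a k : QuaternionGroup n) ∉ g.range → (δ ^ k.val) ^ 8 ≠ 1 := by
    intro k hk h8
    obtain ⟨q, hq⟩ := hdiag _ h8
    exact hk ⟨q, hψinj (by rw [← hcomp', hq, hψa])⟩
  have hδpow : ∀ k : ℕ, (δ ^ k) ^ (2 * n) = 1 := fun k => by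
    rw [← pow_mul, mul_comm, pow_mul, hδ.pow_eq_one, one_pow]
  obtain ⟨V, h2⟩ := exists_valuation_two_lt_one
  let F := amalgamDesc φ ψ
  have hk : ∀ b, (F b).comp (amalgamMap f g b) = φ.comp f := by
    rintro (_ | _)
    · rfl
    · exact hcomp.symm
  have hinj : Function.Injective (Monoid.PushoutI.lift F (φ.comp f) hk) := by
    refine lift_injective_of_ping_pong F (XS := nearSet V.valuation) (XT := farSet V.valuation)
      ?_ _ hk ?_ ?_ ?_ ?_ ?_ ?_
    · rintro (_ | _)
      · exact hf
      · exact hg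
    · rintro (_ | _)
      · exact hφinj
      · exact hψinj
    · intro s hs b
      obtain ⟨p, u, w, h, e, hp, hu, hw, hpw⟩ := hdense s hs
      change φ s * ψ b ∈ _
      rw [e]
      cases b with
      | a k => rw [hψa]; exact dense_mul_diagSU2_mem_nearSet h2 hp hu hw hpw _
      | xa k =>
        obtain ⟨b, hb⟩ := hψxa k
        rw [hb]; exact dense_mul_antiSU2_mem_nearSet h2 hp hu hw hpw _
    · intro s hs t ht
      obtain ⟨p, u, w, h, e, hp, hu, hw, hpw⟩ := hdense s hs
      change φ s * t ∈ _
      rw [e]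
      exact dense_mul_mem_nearSet_of_far h2 hp hu hw hpw ht
    · intro b hb t ht
      change b ∉ g.range at hb
      change ψ b * t ∈ _
      cases b with
      | a k =>
        rw [hψa]
        exact diagSU2_mul_mem_farSet h2 (mul_ne_zero two_ne_zero hn) (hδpow _) (hroot k hb) ht
      | xa k =>
        -- write `x a^k` as a diagonal element times the inverse of `g x`
        obtain ⟨l, hl⟩ : ∃ l, (xa k * xa j : QuaternionGroup n) = a l := ⟨_, xa_mul_xa k j⟩
        have hl' : (a l : QuaternionGroup n) ∉ g.range := by
          rintro ⟨q, hq⟩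
          refine hb ⟨q * (xa 0)⁻¹, ?_⟩
          rw [map_mul, map_inv, hq, hj, ← hl, mul_inv_cancel_right]
        have e : ψ (xa k) = diagSU2 (δ ^ l.val) * antiSU2 (-y) := by
          rw [← antiSU2_inv, ← hψxj, ← hψa, ← hl, map_mul, mul_inv_cancel_right]
        rw [e, mul_assoc]
        refine diagSU2_mul_mem_farSet h2 (mul_ne_zero two_ne_zero hn) (hδpow _) (hroot l hl')
          (antiSU2_mul_mem_nearSet h2 ?_ ht)
        apply Circle.ext
        rw [Circle.coe_pow, Circle.coe_neg, neg_pow, ← Circle.coe_pow, hy8]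
        norm_num
    · intro b
      change ψ b ∉ _
      cases b with
      | a k => rw [hψa]; exact diagSU2_notMem_nearSet h2 _
      | xa k =>
        obtain ⟨b, hb⟩ := hψxa k
        rw [hb]; exact antiSU2_notMem_nearSet _
    · intro b
      change ψ b ∉ _
      cases b with
      | a k => rw [hψa]; exact diagSU2_notMem_farSet _
      | xa k =>
        obtain ⟨b, hb⟩ := hψxa k
        rw [hb]; exact antiSU2_notMem_farSet _
  have hψH : ∀ b, ψ b ∈ groupH n := by
    have hda : ∀ k, ψ (a k) ∈ groupH n := fun k => by
      rw [hψa, diagSU2_apply]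
      exact diag_mem_groupH hn (by rw [← Circle.coe_pow, hδpow, Circle.coe_one])
    intro b
    cases b with
    | a k => exact hda k
    | xa k =>
      have hx : ψ (xa j) ∈ groupH n := by
        rw [← hj, ← hcomp']; exact E48_le_groupH n (hφE _)
      have e : (xa k : QuaternionGroup n) = xa j * a (k - j) := by simp
      rw [e, map_mul]
      exact mul_mem hx (hda _)
  have hrange : (Monoid.PushoutI.lift F (φ.comp f) hk).range = groupH n := by
    apply le_antisymm
    · rintro _ ⟨x, rfl⟩
      induction x using Monoid.PushoutI.induction_on with
      | of b s =>
        rw [Monoid.PushoutI.lift_of]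
        cases b
        · exact E48_le_groupH n (hφE s)
        · exact hψH s
      | base q => rw [Monoid.PushoutI.lift_base]; exact E48_le_groupH n (hφE _)
      | mul x y hx hy => rw [map_mul]; exact mul_mem hx hy
    · obtain ⟨k, hk'⟩ := circle_eq_pow_of_pow_eq_one (c := ζ⁻¹) (mul_ne_zero two_ne_zero hn) hδ
        (by rw [inv_pow, hζ.pow_eq_one, inv_one])
      refine groupH_le ?_ (d := (ζ⁻¹ : Circle)) (h := by simp) ?_ ?_
      · intro s hs
        let s' : E48 := ⟨c⁻¹ * s * c, mul_mem (mul_mem (inv_mem hc) hs) hc⟩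
        refine ⟨Monoid.PushoutI.of (φ := amalgamMap f g) false s',
          (Monoid.PushoutI.lift_of F _ hk (i := false) s').trans ?_⟩
        change c * (c⁻¹ * s * c) * c⁻¹ = s
        group
      · rw [conj_circle, inv_inv, hζ', zeta_two_mul_sq hn]
      · refine ⟨Monoid.PushoutI.of (φ := amalgamMap f g) true (a k : QuaternionGroup n),
          (Monoid.PushoutI.lift_of F _ hk (i := true) (a k : QuaternionGroup n)).trans ?_⟩
        change ψ (a k) = diagSU2 ζ⁻¹
        rw [hψa, hk', pow_zmod_val_natCast hδ.pow_eq_one]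
  exact ⟨((MonoidHom.ofInjective hinj).trans (MulEquiv.subgroupCongr hrange)).symm⟩

theorem diagSU2_mem_E48 {d : Circle} (h8 : d ^ 8 = 1) : diagSU2 d ∈ E48 := by
  refine mem_E48_of_clifford (c := d⁻¹) ?_
  rw [diagSU2_apply]
  refine scalar_mul_mk_mem (by norm_num) ?_ ?_ ?_ ?_
  · rw [← Circle.coe_mul, inv_mul_cancel, Circle.coe_one]; exact one_mem _
  · simp
  · simp
  · refine mem_ringR_of_pow_four ?_
    rw [conj_circle, ← Circle.coe_mul, ← Circle.coe_pow, ← sq, ← pow_mul, inv_pow, h8, inv_one,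
      Circle.coe_one]

theorem exists_injective_quaternion_E48 :
    ∃ f : QuaternionGroup 4 →* E48, Function.Injective f := by
  obtain ⟨δ, hδ'⟩ := exists_circle_eq (zeta_normSq (2 * 4))
  have hδ : IsPrimitiveRoot δ (2 * 4) := by
    rw [← isPrimitiveRoot_circle_coe, hδ']
    exact isPrimitiveRoot_zeta (by norm_num)
  have hmem : ∀ q, monomialHom δ 1 hδ q ∈ E48 := by
    have hd : ∀ k : ℕ, diagSU2 (δ ^ k) ∈ E48 := fun k => diagSU2_mem_E48 (by
      rw [← pow_mul, mul_comm, pow_mul, hδ.pow_eq_one, one_pow])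
    intro q
    cases q with
    | a i => rw [monomialHom_a]; exact hd _
    | xa i =>
      rw [monomialHom_xa, ← antiSU2_mul_diagSU2]
      exact mul_mem flip_mem_E48 (hd _)
  refine ⟨(monomialHom δ 1 hδ).codRestrict E48 hmem, fun x y h => ?_⟩
  exact monomialHom_injective hδ (congrArg Subtype.val h)

theorem exists_injective_quaternion {n : ℕ} (hn : n ≠ 0) (h4 : 4 ∣ n) :
    ∃ g : QuaternionGroup 4 →* QuaternionGroup n, Function.Injective g := by
  have : NeZero n := ⟨hn⟩
  obtain ⟨k, rfl⟩ := h4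
  have hk : k ≠ 0 := (mul_ne_zero_iff.1 hn).2
  refine ⟨quaternionLift (a 1 ^ k) (xa 0) ?_ ?_ ?_, quaternionLift_injective ?_ fun m => ?_⟩
  · rw [← pow_mul, show k * (2 * 4) = 2 * (4 * k) by ring, a_one_pow_n]
  · rw [← sq, xa_sq, ← pow_mul, a_one_pow, mul_comm]
  · rw [a_one_pow, eq_mul_inv_iff_mul_eq]
    simp
  · have h1 : orderOf (a 1 : QuaternionGroup (4 * k)) = 2 * 4 * k := by
      rw [orderOf_a_one, mul_assoc]
    rw [orderOf_pow_of_dvd hk (by rw [h1]; exact Dvd.intro_left _ rfl), h1,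
      Nat.mul_div_cancel _ (Nat.pos_of_ne_zero hk)]
  · rw [← pow_mul, a_one_pow, xa_mul_a, one_def]
    exact nofun

end Amalgamated

end CliffordCyclotomic

open CliffordCyclotomic in
theorem mainTheorem9 (n : ℕ) (hn : 0 < n) (h4 : 4 ∣ n) :
    groupSG n ≤ groupH n ∧
    (groupSG n).relIndex (groupH n) = 2 ∧
    (∃ f : QuaternionGroup 4 →* E48, Function.Injective f) ∧
    (∃ g : QuaternionGroup 4 →* QuaternionGroup n, Function.Injective g) ∧
    ∀ (f : QuaternionGroup 4 →* E48) (g : QuaternionGroup 4 →* QuaternionGroup n),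
      Function.Injective f → Function.Injective g →
        Nonempty (groupH n ≃* Amalgam f g) :=
  ⟨groupSG_le_groupH n, relIndex_groupSG hn.ne' h4, exists_injective_quaternion_E48,
    exists_injective_quaternion hn.ne' h4,
    fun _ _ hf hg => nonempty_groupH_mulEquiv_amalgam hn.ne' h4 hf hg⟩
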